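/- Let $P$ be a probability on a measurable space $(\Omega,\mathcal B)$, write $L_2=L_2(P)$ with norm $\|\cdot\|$ and inner product $\langle\cdot|\cdot\rangle$, and let $G_0,G_1\subset\{g\in L_2: \int g\,dP=0\}$ be nonempty, disjoint, convex and closed sets such that the set of differences $G_1-G_0=\{g_1-g_0: g_0\in G_0,\ g_1\in G_1\}$ is closed in $L_2$. For each $\rho\in G_0\cup G_1$ let $(P_{n,\rho})_n$ be any sequence of probabilities on $(\Omega,\mathcal B)$ such that, in the Hilbert space of square root densities, $\sqrt{dP_{n,\rho}}=\bigl(1+\tfrac1{2\sqrt n}\rho\bigr)\sqrt{dP}+o(1/\sqrt n)$ as $n\to\infty$. Let $\alpha\in(0,1)$, let $\Phi$ be the standard normal distribution function and $u_\alpha=\Phi^{-1}(1-\alpha)$. An asymptotic test is a sequence $\delta=(\delta_n)$ of measurable functions $\delta_n:\Omega^n\to[0,1]$. The maxmin testing problem $H_{G_0}$ vs. $K_{G_1}$ at level $\alpha$ is to maximize $\inf_{g_1\in G_1}\liminf_n\int\delta_n\,dP_{n,g_1}^n$ over all asymptotic tests subject to $\sup_{g_0\in G_0}\limsup_n\int\delta_n\,dP_{n,g_0}^n\le\alpha$.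 For $g=(g_0,g_1)\in G_0\times G_1$ and $g_{10}=g_1-g_0$ let $\delta_g$ be the asymptotic test $$\delta_{n,g}=\mathbf 1\Bigl(\tfrac1{\sqrt n}\sum_{i=1}^n g_{10}(x_i)>\|g_{10}\|u_\alpha+\langle g_{10}|g_0\rangle\Bigr).$$ Theorem. $G_1-G_0$ has a unique element of minimum norm. Let $q_0\in G_0$ and $q_1\in G_1$ be any two tangents such that $q_1-q_0$ is this element, and put $q=(q_0,q_1)$. Then $q_1-q_0\neq0$ and: (a) The problem $H_{G_0}$ vs. $K_{G_1}$ at level $\alpha$ has a saddle point at $q=(q_0,q_1)$. That is, $\delta_q$ maximizes $\liminf_n\int\delta_n\,dP_{n,q_1}^n$ over all asymptotic tests subject to $\limsup_n\int\delta_n\,dP_{n,q_0}^n\le\alpha$; over $g_0\in G_0$ the asymptotic size $\limsup_n\int\delta_{n,q}\,dP_{n,g_0}^n$ is maximal at $g_0=q_0$; and over $g_1\in G_1$ the asymptotic power $\liminf_n\int\delta_{n,q}\,dP_{n,g_1}^n$ is minimal at $g_1=q_1$. (b) $\delta_q$ solves the maxmin testing problem $H_{G_0}$ vs. $K_{G_1}$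 at level $\alpha$, and the maxmin asymptotic power it attains equals $$\inf_{g_1\in G_1}\liminf_n\int\delta_{n,q}\,dP_{n,g_1}^n=\Phi\bigl(-u_\alpha+\|q_1-q_0\|\bigr).$$ -/

import Mathlib

open MeasureTheory ProbabilityTheory Filter Topology Set
open scoped ENNReal Pointwise

noncomputable section

/-- `√dQ - (1 + (s/2) ρ) √dP` as a square root density, written with respect to the dominating
measure `P + Q`. The `L₂` norm of this element does not depend on the dominating measure. -/
def rootRemainder {Ω : Type*} [MeasurableSpace Ω] (P Q : Measure Ω) (ρ : Ω → ℝ) (s : ℝ) (x : Ω) :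
    ℝ :=
  √((Q.rnDeriv (P + Q) x).toReal) - (1 + s / 2 * ρ x) * √((P.rnDeriv (P + Q) x).toReal)

/-- `Q n` is a sequence of local alternatives of `P` with tangent `ρ`:
`√dQₙ = (1 + (sₙ/2) ρ) √dP + o(sₙ)` in the Hilbert space of square root densities,
where `sₙ = 1/√n`. -/
def IsLocalAlternative {Ω : Type*} [MeasurableSpace Ω] (P : Measure Ω) (ρ : Lp ℝ 2 P)
    (Q : ℕ → ProbabilityMeasure Ω) : Prop :=
  Tendsto (fun n : ℕ => ENNReal.ofReal (√(n : ℝ)) *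
      eLpNorm (rootRemainder P (Q n : Measure Ω) ρ (1 / √(n : ℝ))) 2 (P + (Q n : Measure Ω)))
    atTop (𝓝 0)

/-- An asymptotic test: for every sample size `n` a (possibly randomized) test on `Ωⁿ`. -/
structure AsymptoticTest (Ω : Type*) [MeasurableSpace Ω] where
  toFun : (n : ℕ) → (Fin n → Ω) → ℝ
  measurable_toFun : ∀ n, Measurable (toFun n)
  mem_Icc : ∀ n x, toFun n x ∈ Icc (0 : ℝ) 1

/-- `∫ δₙ dQⁿ`, the rejection probability at sample size `n` when the observations are
i.i.d. with distribution `Q`. -/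
def rejectionProb {Ω : Type*} [MeasurableSpace Ω] (δ : AsymptoticTest Ω) (n : ℕ)
    (Q : ProbabilityMeasure Ω) : ℝ :=
  ∫ x, δ.toFun n x ∂(Measure.pi fun _ : Fin n => (Q : Measure Ω))

/-- Asymptotic size of `δ` under the sequence `Q n`: `limsup ∫ δₙ dQₙⁿ`. -/
def asympSize {Ω : Type*} [MeasurableSpace Ω] (δ : AsymptoticTest Ω)
    (Q : ℕ → ProbabilityMeasure Ω) : ℝ :=
  limsup (fun n => rejectionProb δ n (Q n)) atTop

/-- Asymptotic power of `δ` under the sequence `Q n`: `liminf ∫ δₙ dQₙⁿ`. -/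
def asympPower {Ω : Type*} [MeasurableSpace Ω] (δ : AsymptoticTest Ω)
    (Q : ℕ → ProbabilityMeasure Ω) : ℝ :=
  liminf (fun n => rejectionProb δ n (Q n)) atTop

/-- `sup_{g₀ ∈ G₀} limsup ∫ δₙ dP_{n,g₀}ⁿ`, where `Q ρ n` stands for `P_{n,ρ}`. -/
def maxSize {Ω T : Type*} [MeasurableSpace Ω] (Q : T → ℕ → ProbabilityMeasure Ω) (G₀ : Set T)
    (δ : AsymptoticTest Ω) : ℝ :=
  ⨆ g₀ : G₀, asympSize δ (Q g₀)

/-- `inf_{g₁ ∈ G₁} liminf ∫ δₙ dP_{n,g₁}ⁿ`, where `Q ρ n` stands for `P_{n,ρ}`. -/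
def minPower {Ω T : Type*} [MeasurableSpace Ω] (Q : T → ℕ → ProbabilityMeasure Ω) (G₁ : Set T)
    (δ : AsymptoticTest Ω) : ℝ :=
  ⨅ g₁ : G₁, asympPower δ (Q g₁)

/-- `δ` solves the maxmin testing problem `H_{G₀}` vs. `K_{G₁}` at level `α`: it maximizes the
minimal asymptotic power over `G₁`, subject to maximal asymptotic size over `G₀` at most `α`.
Singletons `G₀ = {g₀}`, `G₁ = {g₁}` give the simple testing problem `H_{g₀}` vs. `K_{g₁}`. -/
def IsMaxminTest {Ω T : Type*} [MeasurableSpace Ω] (Q : T → ℕ → ProbabilityMeasure Ω)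
    (G₀ G₁ : Set T) (α : ℝ) (δ : AsymptoticTest Ω) : Prop :=
  maxSize Q G₀ δ ≤ α ∧
    ∀ δ' : AsymptoticTest Ω, maxSize Q G₀ δ' ≤ α → minPower Q G₁ δ' ≤ minPower Q G₁ δ

/-- The pair `(q₀, q₁)`, with test `δ`, is a saddle point of the testing problem `H_{G₀}` vs.
`K_{G₁}` at level `α`: `δ` is optimal for the simple problem `H_{q₀}` vs. `K_{q₁}`, and over
`G₀` and `G₁` the asymptotic size of `δ` is maximal at `q₀` and its asymptotic power is minimal
at `q₁`. -/
structure IsSaddlePoint {Ω T : Type*} [MeasurableSpace Ω] (Q : T → ℕ → ProbabilityMeasure Ω)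
    (G₀ G₁ : Set T) (α : ℝ) (δ : AsymptoticTest Ω) (q₀ q₁ : T) : Prop where
  mem₀ : q₀ ∈ G₀
  mem₁ : q₁ ∈ G₁
  optimal : IsMaxminTest Q {q₀} {q₁} α δ
  size_le : ∀ g₀ ∈ G₀, asympSize δ (Q g₀) ≤ asympSize δ (Q q₀)
  le_power : ∀ g₁ ∈ G₁, asympPower δ (Q q₁) ≤ asympPower δ (Q g₁)

/-- The standard normal distribution function `Φ`. -/
def stdNormalCDF (x : ℝ) : ℝ := cdf (gaussianReal 0 1) x

/-- The standard normal upper `α` point `u_α`, i.e. the `(1 - α)`-quantile of `N(0,1)`. -/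
def upperPoint (α : ℝ) : ℝ := sInf {u : ℝ | 1 - α ≤ stdNormalCDF u}

/-- The Neyman–Pearson type test `δ_g` for `g = (g₀, g₁)`: with `g₁₀ = g₁ - g₀`, reject iff
`(1/√n) ∑ g₁₀(xᵢ) > ‖g₁₀‖ u_α + ⟨g₁₀, g₀⟩`. -/
def npTest {Ω : Type*} [MeasurableSpace Ω] {P : Measure Ω} (α : ℝ) (g₀ g₁ : Lp ℝ 2 P) :
    AsymptoticTest Ω where
  toFun n := {x : Fin n → Ω | ‖g₁ - g₀‖ * upperPoint α + inner ℝ (g₁ - g₀) g₀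
      < 1 / √(n : ℝ) * ∑ i, (g₁ - g₀ : Lp ℝ 2 P) (x i)}.indicator 1
  measurable_toFun n := by
    refine measurable_one.indicator (measurableSet_lt measurable_const ?_)
    refine Measurable.const_mul (Finset.measurable_sum _ fun i _ => ?_) _
    exact (Lp.stronglyMeasurable (g₁ - g₀)).measurable.comp (measurable_pi_apply i)
  mem_Icc n x := by
    by_cases h : x ∈ {x : Fin n → Ω | ‖g₁ - g₀‖ * upperPoint α + inner ℝ (g₁ - g₀) g₀
      < 1 / √(n : ℝ) * ∑ i, (g₁ - g₀ : Lp ℝ 2 P) (x i)}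
    · rw [indicator_of_mem h]; simp
    · rw [indicator_of_notMem h]; simp

end

/-! The tests `δ_g` reject for large values of `Tₙ = n^(-1/2) ∑ h(xᵢ)` with `h = g₁ - g₀`. Under
local alternatives with tangent `ρ`, `Tₙ` converges in law to `N(⟨h, ρ⟩, ‖h‖²)`, so for `h ≠ 0` the
rejection probability of `δ_g` tends to `Φ(⟨h, ρ - g₀⟩/‖h‖ - u_α)` (`tendsto_rejectionProb_npTest`),
which is increasing in `⟨h, ρ⟩`. If `q₁ - q₀` has minimum norm in the convex set `G₁ - G₀`, then
`⟨q₁ - q₀, g₁ - g₀⟩ ≥ ‖q₁ - q₀‖²` (`norm_sq_le_inner_of_forall_norm_le`). With `g₁ = q₁` this makes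
the size of `δ_q` worst at `q₀`; with `g₀ = q₀` it makes the power worst at `q₁`. Since `δ_q` is
also optimal for `q₀` against `q₁` (`asympPower_le_of_asympSize_le`), `q` is a saddle point, and the
maxmin property follows.

Normality and optimality both come from one substitution. Only the root density of `P_{n,ρ}` is
controlled, up to `o(1/√n)`, so `P_{n,ρ}` is replaced by the probability with density proportional
to `exp(ρ/√n)` on `{b ≤ √n}`, where `b ∈ L₂` dominates the tangents involved. The truncation keeps
the exponential bounded although `ρ` is merely square integrable. The two sequences have Hellinger
distance `o(1/√n)`, hence bounded integrals over their `n`-fold products differ by `o(1)`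
(`IsLocalAlternative.tendsto_integral_pi_sub_tiltMeasure`). For the tilts everything is explicit:
characteristic functions are powers of one truncated exponential integral, and the likelihood ratio
of two product tilts is an increasing function of `Tₙ`, so the Neyman–Pearson lemma applies exactly
at each sample size (`integral_pi_tiltMeasure_sub_le`). -/

/-! ### Truncated exponential integrals -/

/-- Second order expansion of an exponential integral, truncated at level `√n`. -/
theorem tendsto_nat_mul_integral_trunc_exp_sub_one {Ω : Type*} [MeasurableSpace Ω]
    {P : Measure Ω} [IsProbabilityMeasure P] {z : Ω → ℂ} {b : Ω → ℝ} {C : ℝ}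
    (hz : Measurable z) (hb : Measurable b) (hbL : MemLp b 2 P)
    (hC : 0 ≤ C) (hzb : ∀ x, ‖z x‖ ≤ C * b x) (hz0 : ∫ x, z x ∂P = 0) :
    Tendsto (fun n : ℕ => (n : ℂ) *
      (∫ x, {x | b x ≤ √(n : ℝ)}.indicator (fun x => Complex.exp (z x / (√(n : ℝ) : ℝ))) x ∂P - 1))
      atTop (𝓝 (∫ x, z x ^ 2 / 2 ∂P)) := by
  have hzi : Integrable z P := by
    refine ((hbL.integrable (by norm_num)).const_mul C).mono' hz.aestronglyMeasurable ?_
    exact Eventually.of_forall hzb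
  have hA (n : ℕ) : MeasurableSet {x | b x ≤ √(n : ℝ)} := measurableSet_le hb measurable_const
  have hbd (n : ℕ) (x : Ω) (hx : b x ≤ √(n : ℝ)) (hn : 1 ≤ n) :
      ‖z x / (√(n : ℝ) : ℝ)‖ ≤ C := by
    have : (0 : ℝ) < √(n : ℝ) := Real.sqrt_pos.2 (by exact_mod_cast hn)
    rw [norm_div, Complex.norm_real, Real.norm_of_nonneg this.le, div_le_iff₀ this]
    exact (hzb x).trans (mul_le_mul_of_nonneg_left hx hC)
  have hei (n : ℕ) (hn : 1 ≤ n) : Integrable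
      ({x | b x ≤ √(n : ℝ)}.indicator (fun x => Complex.exp (z x / (√(n : ℝ) : ℝ)))) P := by
    refine (integrable_const (Real.exp C)).mono'
      (((hz.div_const _).cexp.indicator (hA n)).aestronglyMeasurable) ?_
    refine Eventually.of_forall fun x => ?_
    by_cases hx : x ∈ {x | b x ≤ √(n : ℝ)}
    · rw [indicator_of_mem hx, Complex.norm_exp]
      exact Real.exp_le_exp.2 ((Complex.re_le_norm _).trans (hbd n x hx hn))
    · rw [indicator_of_notMem hx]; simpa using (Real.exp_pos C).le
  -- The linear term integrates to zero because `z` is centred; subtracting it leaves a remainder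
  -- that, even after multiplication by `n`, is dominated by a multiple of `b²`.
  let F : ℕ → Ω → ℂ := fun n x => (n : ℂ) *
    ({x | b x ≤ √(n : ℝ)}.indicator (fun x => Complex.exp (z x / (√(n : ℝ) : ℝ))) x - 1
      - z x / (√(n : ℝ) : ℝ))
  have key : Tendsto (fun n => ∫ x, F n x ∂P) atTop (𝓝 (∫ x, z x ^ 2 / 2 ∂P)) := by
    -- `C² exp C` pays for the Taylor remainder on `{b ≤ √n}`; `1 + C` pays for the cut-off part,
    -- where `√n < b` turns each factor `√n` into `b`.
    have hb2 : Integrable (fun x => (C ^ 2 * Real.exp C + 1 + C) * b x ^ 2) P :=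
      hbL.integrable_sq.const_mul _
    refine tendsto_integral_filter_of_dominated_convergence _ ?_ ?_ hb2 ?_
    · refine Eventually.of_forall fun n => Measurable.aestronglyMeasurable ?_
      exact measurable_const.mul (((((hz.div_const _).cexp.indicator (hA n)).sub_const 1).sub
        (hz.div_const _)))
    · filter_upwards [eventually_ge_atTop 1] with n hn
      refine Eventually.of_forall fun x => ?_
      have hs : (1 : ℝ) ≤ √(n : ℝ) := Real.one_le_sqrt.2 (by exact_mod_cast hn)
      have hss : √(n : ℝ) ^ 2 = n := Real.sq_sqrt (Nat.cast_nonneg n)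
      have hn' : (‖(n : ℂ)‖ : ℝ) = √(n : ℝ) ^ 2 := by rw [hss]; simp
      have hw : ‖z x / (√(n : ℝ) : ℝ)‖ * √(n : ℝ) = ‖z x‖ := by
        rw [norm_div, Complex.norm_real, Real.norm_of_nonneg (by positivity)]
        field_simp
      have hE := Real.exp_pos C
      have hF₁ : b x ≤ √(n : ℝ) →
          F n x = n * (Complex.exp (z x / (√(n : ℝ) : ℝ)) - 1 - z x / (√(n : ℝ) : ℝ)) := fun hx => by
        simp only [F]
        rw [indicator_of_mem (by exact hx)]
      have hF₂ : ¬ b x ≤ √(n : ℝ) → F n x = n * (0 - 1 - z x / (√(n : ℝ) : ℝ)) := fun hx => by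
        simp only [F]
        rw [indicator_of_notMem (by exact hx)]
      have hbd' := hbd n x
      clear_value F
      generalize √(n : ℝ) = s at *
      generalize z x / (s : ℂ) = w at *
      by_cases hx : b x ≤ s
      · have h1 : ‖Complex.exp w - 1 - w‖ ≤ ‖w‖ ^ 2 * Real.exp ‖w‖ := by
          have := Complex.norm_exp_sub_sum_le_norm_mul_exp w 2
          simpa [Finset.sum_range_succ, sub_sub] using this
        have h2 : ‖w‖ ≤ C := hbd' hx hn
        have h3 : Real.exp ‖w‖ ≤ Real.exp C := Real.exp_le_exp.2 h2
        rw [hF₁ hx, norm_mul, hn']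
        have h4 : ‖z x‖ ^ 2 ≤ C ^ 2 * b x ^ 2 := by
          rw [← mul_pow]; exact pow_le_pow_left₀ (norm_nonneg _) (hzb x) 2
        calc s ^ 2 * ‖Complex.exp w - 1 - w‖ ≤ s ^ 2 * (‖w‖ ^ 2 * Real.exp C) := by
              gcongr; exact h1.trans (by gcongr)
          _ = ‖z x‖ ^ 2 * Real.exp C := by rw [← hw]; ring
          _ ≤ C ^ 2 * b x ^ 2 * Real.exp C := by gcongr
          _ ≤ _ := by nlinarith [sq_nonneg (b x), mul_nonneg hC (sq_nonneg (b x))]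
      · have hx' : s < b x := not_le.1 hx
        rw [hF₂ hx, norm_mul, hn']
        have h1 : ‖(0 : ℂ) - 1 - w‖ ≤ 1 + ‖w‖ := by
          refine (norm_sub_le _ _).trans ?_
          simp
        have h5 : s * s ≤ b x * b x := by nlinarith
        have h6 : s * (C * b x) ≤ b x * (C * b x) := by
          have : 0 ≤ C * b x := by have : 0 ≤ b x := by linarith
                                   positivity
          exact mul_le_mul_of_nonneg_right hx'.le this
        calc s ^ 2 * ‖(0 : ℂ) - 1 - w‖ ≤ s ^ 2 * (1 + ‖w‖) := by gcongr
          _ = s ^ 2 + s * ‖z x‖ := by rw [← hw]; ring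
          _ ≤ s ^ 2 + s * (C * b x) := by gcongr; exact hzb x
          _ ≤ (1 + C) * b x ^ 2 := by nlinarith
          _ ≤ _ := by nlinarith [mul_nonneg (mul_nonneg (sq_nonneg C) hE.le) (sq_nonneg (b x))]
    · refine Eventually.of_forall fun x => ?_
      have hsq : Tendsto (fun n : ℕ => √(n : ℝ)) atTop atTop :=
        Real.tendsto_sqrt_atTop.comp tendsto_natCast_atTop_atTop
      by_cases hz' : z x = 0
      · simp only [hz']
        have : ∀ᶠ n : ℕ in atTop, F n x = 0 := by
          filter_upwards [hsq.eventually_ge_atTop (b x)] with n hn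
          have : x ∈ {x | b x ≤ √(n : ℝ)} := hn
          simp [F, indicator_of_mem this, hz']
        simpa using tendsto_const_nhds.congr' (this.mono fun n hn => hn.symm)
      · have hw0 : Tendsto (fun n : ℕ => z x / (√(n : ℝ) : ℝ)) atTop (𝓝 0) := by
          have : Tendsto (fun n : ℕ => ((√(n : ℝ))⁻¹ : ℝ)) atTop (𝓝 0) := hsq.inv_tendsto_atTop
          have := (Complex.continuous_ofReal.tendsto _).comp this
          simpa [div_eq_mul_inv, Function.comp_def] using this.const_mul (z x)
        have hlim : Tendsto (fun w : ℂ => (Complex.exp w - 1 - w) / w ^ 2) (𝓝[≠] 0) (𝓝 (1 / 2)) := by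
          rw [tendsto_iff_norm_sub_tendsto_zero]
          have hup : Tendsto (fun w : ℂ => ‖w‖ * Real.exp ‖w‖) (𝓝[≠] 0) (𝓝 0) := by
            have : Continuous (fun w : ℂ => ‖w‖ * Real.exp ‖w‖) := by fun_prop
            simpa using (this.tendsto 0).mono_left nhdsWithin_le_nhds
          refine squeeze_zero' (Eventually.of_forall fun _ => norm_nonneg _) ?_ hup
          filter_upwards [self_mem_nhdsWithin] with w hw
          have hw : w ≠ 0 := hw
          have h3 := Complex.norm_exp_sub_sum_le_norm_mul_exp w 3
          simp only [Finset.sum_range_succ, Finset.sum_range_zero] at h3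
          norm_num at h3
          have : (Complex.exp w - 1 - w) / w ^ 2 - 1 / 2
              = (Complex.exp w - (1 + w + w ^ 2 / 2)) / w ^ 2 := by field_simp; ring
          rw [this, norm_div, norm_pow, div_le_iff₀ (by positivity)]
          calc _ ≤ _ := h3
            _ = _ := by ring
        have hw1 : Tendsto (fun n : ℕ => z x / (√(n : ℝ) : ℝ)) atTop (𝓝[≠] 0) := by
          refine tendsto_nhdsWithin_iff.2 ⟨hw0, ?_⟩
          filter_upwards [eventually_ge_atTop 1] with n hn
          have : (0 : ℝ) < √(n : ℝ) := Real.sqrt_pos.2 (by exact_mod_cast hn)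
          exact div_ne_zero hz' (by exact_mod_cast this.ne')
        have := (hlim.comp hw1).const_mul (z x ^ 2)
        rw [mul_one_div] at this
        refine this.congr' ?_
        filter_upwards [eventually_ge_atTop 1, hsq.eventually_ge_atTop (b x)] with n hn hbn
        have hm : x ∈ {x | b x ≤ √(n : ℝ)} := hbn
        have hs : (0 : ℝ) < √(n : ℝ) := Real.sqrt_pos.2 (by exact_mod_cast hn)
        have hss : (n : ℂ) = ((√(n : ℝ) : ℝ) : ℂ) ^ 2 := by
          rw [← Complex.ofReal_pow, Real.sq_sqrt (Nat.cast_nonneg n)]; simp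
        have hs' : ((√(n : ℝ) : ℝ) : ℂ) ≠ 0 := by exact_mod_cast hs.ne'
        simp only [F, indicator_of_mem hm, Function.comp]
        rw [hss]
        set s : ℂ := ((√(n : ℝ) : ℝ) : ℂ)
        generalize Complex.exp (z x / s) = e
        field_simp
  refine key.congr' ?_
  filter_upwards [eventually_ge_atTop 1] with n hn
  simp only [F]
  rw [integral_const_mul]
  congr 1
  have h1 := integral_sub (μ := P) ((hei n hn).sub (integrable_const 1))
    (hzi.div_const ((√(n : ℝ) : ℝ) : ℂ))
  have h2 := integral_sub (μ := P) (hei n hn) (integrable_const 1)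
  simp only [Pi.sub_apply] at h1 h2
  rw [h1, h2, integral_div, hz0]
  simp

/-- The expansion says that the base is `1 + cₙ/n` with `cₙ` convergent. Complex `z` is allowed so
that `z = ρ + i t h` yields characteristic functions under the tilt by `ρ`. -/
theorem tendsto_integral_trunc_exp_pow {Ω : Type*} [MeasurableSpace Ω]
    {P : Measure Ω} [IsProbabilityMeasure P] {z : Ω → ℂ} {b : Ω → ℝ} {C : ℝ}
    (hz : Measurable z) (hb : Measurable b) (hbL : MemLp b 2 P)
    (hC : 0 ≤ C) (hzb : ∀ x, ‖z x‖ ≤ C * b x) (hz0 : ∫ x, z x ∂P = 0) :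
    Tendsto (fun n : ℕ =>
      (∫ x, {x | b x ≤ √(n : ℝ)}.indicator (fun x => Complex.exp (z x / (√(n : ℝ) : ℝ))) x ∂P) ^ n)
      atTop (𝓝 (Complex.exp (∫ x, z x ^ 2 / 2 ∂P))) := by
  have := Complex.tendsto_one_add_pow_exp_of_tendsto
    (tendsto_nat_mul_integral_trunc_exp_sub_one hz hb hbL hC hzb hz0)
  simpa using this

/-! ### Product densities and Hellinger bounds -/

theorem pi_withDensity_ofReal {Ω : Type*} [MeasurableSpace Ω] {μ : Measure Ω} [SigmaFinite μ]
    (n : ℕ) {d : Ω → ℝ} (hd0 : ∀ x, 0 ≤ d x) (hdi : Integrable d μ) :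
    Measure.pi (fun _ : Fin n => μ.withDensity fun x => ENNReal.ofReal (d x))
      = (Measure.pi fun _ : Fin n => μ).withDensity fun x => ENNReal.ofReal (∏ i, d (x i)) := by
  have : IsFiniteMeasure (μ.withDensity fun x => ENNReal.ofReal (d x)) :=
    isFiniteMeasure_withDensity_ofReal hdi.2
  refine Measure.pi_eq fun s hs => ?_
  have hind (x : Fin n → Ω) : (univ.pi s).indicator (fun x => ENNReal.ofReal (∏ i, d (x i))) x
      = ENNReal.ofReal (∏ i, (s i).indicator d (x i)) := by
    by_cases hx : x ∈ univ.pi s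
    · rw [indicator_of_mem hx]
      congr 1
      exact Finset.prod_congr rfl fun i _ => (indicator_of_mem (hx i (mem_univ i)) d).symm
    · rw [indicator_of_notMem hx]
      obtain ⟨i, hi⟩ : ∃ i, x i ∉ s i := by simpa [Set.mem_pi] using hx
      rw [Finset.prod_eq_zero (Finset.mem_univ i) (indicator_of_notMem hi d)]
      simp
  have hii (i : Fin n) : Integrable ((s i).indicator d) μ := hdi.indicator (hs i)
  rw [withDensity_apply _ (MeasurableSet.univ_pi hs),
    ← lintegral_indicator (MeasurableSet.univ_pi hs)]
  simp_rw [hind]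
  rw [← ofReal_integral_eq_lintegral_ofReal (Integrable.fintype_prod hii)
    (Eventually.of_forall fun x => Finset.prod_nonneg fun i _ => indicator_nonneg (fun y _ => hd0 y) _),
    integral_fintype_prod_eq_prod,
    ENNReal.ofReal_prod_of_nonneg fun i _ => integral_nonneg (indicator_nonneg fun y _ => hd0 y)]
  refine Finset.prod_congr rfl fun i _ => ?_
  rw [withDensity_apply _ (hs i), integral_indicator (hs i),
    ofReal_integral_eq_lintegral_ofReal hdi.integrableOn (Eventually.of_forall hd0)]

theorem integral_pi_withDensity_ofReal {Ω E : Type*} [MeasurableSpace Ω] [NormedAddCommGroup E]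
    [NormedSpace ℝ E] {μ : Measure Ω} [SigmaFinite μ]
    (n : ℕ) {d : Ω → ℝ} (hd : Measurable d) (hd0 : ∀ x, 0 ≤ d x) (hdi : Integrable d μ)
    (δ : (Fin n → Ω) → E) :
    ∫ x, δ x ∂Measure.pi (fun _ : Fin n => μ.withDensity fun x => ENNReal.ofReal (d x))
      = ∫ x, (∏ i, d (x i)) • δ x ∂Measure.pi fun _ : Fin n => μ := by
  rw [pi_withDensity_ofReal n hd0 hdi, integral_withDensity_eq_integral_toReal_smul]
  · refine integral_congr_ae (Eventually.of_forall fun x => ?_)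
    simp only
    rw [ENNReal.toReal_ofReal (Finset.prod_nonneg fun i _ => hd0 _)]
  · exact (Finset.measurable_prod _ fun i _ => hd.comp (measurable_pi_apply i)).ennreal_ofReal
  · exact Eventually.of_forall fun x => ENNReal.ofReal_lt_top

theorem integral_abs_mul_le_sqrt_mul_sqrt {X : Type*} [MeasurableSpace X] {μ : Measure X}
    {f g : X → ℝ} (hf : MemLp f 2 μ) (hg : MemLp g 2 μ) :
    ∫ x, |f x| * |g x| ∂μ ≤ √(∫ x, f x ^ 2 ∂μ) * √(∫ x, g x ^ 2 ∂μ) := by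
  have h := integral_mul_le_Lp_mul_Lq_of_nonneg (μ := μ) Real.HolderConjugate.two_two
    (Eventually.of_forall fun x => abs_nonneg (f x)) (Eventually.of_forall fun x => abs_nonneg (g x))
    (by simpa using hf.norm) (by simpa using hg.norm)
  simpa [Real.sqrt_eq_rpow] using h

theorem integral_add_const_mul_sq {X : Type*} [MeasurableSpace X] {m : Measure X} {u v : X → ℝ}
    (hu : MemLp u 2 m) (hv : MemLp v 2 m) (c : ℝ) :
    ∫ x, (u x + c * v x) ^ 2 ∂m
      = ∫ x, u x ^ 2 ∂m + c ^ 2 * ∫ x, v x ^ 2 ∂m + 2 * c * ∫ x, u x * v x ∂m := by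
  have huv : Integrable (fun x => u x * v x) m := hu.integrable_mul hv
  have h1 : Integrable (fun x => u x ^ 2 + c ^ 2 * v x ^ 2) m :=
    hu.integrable_sq.add (hv.integrable_sq.const_mul _)
  rw [← integral_const_mul, ← integral_const_mul,
    ← integral_add hu.integrable_sq (hv.integrable_sq.const_mul _),
    ← integral_add h1 (huv.const_mul _)]
  congr 1 with x
  ring

/-- Testing affinity of product measures in terms of the Hellinger distance of the factors. -/
theorem norm_integral_prod_sq_sub_le {Ω E : Type*} [MeasurableSpace Ω] [NormedAddCommGroup E]
    [NormedSpace ℝ E] {μ : Measure Ω} [SigmaFinite μ] (n : ℕ) {f g : Ω → ℝ}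
    (hf : MemLp f 2 μ) (hg : MemLp g 2 μ) (hf0 : ∀ x, 0 ≤ f x) (hg0 : ∀ x, 0 ≤ g x)
    (hf1 : ∫ x, f x ^ 2 ∂μ = 1) (hg1 : ∫ x, g x ^ 2 ∂μ = 1)
    {δ : (Fin n → Ω) → E} (hδ : AEStronglyMeasurable δ (Measure.pi fun _ : Fin n => μ))
    (hδ1 : ∀ x, ‖δ x‖ ≤ 1) :
    ‖∫ x, (∏ i, f (x i) ^ 2) • δ x ∂(Measure.pi fun _ : Fin n => μ)
      - ∫ x, (∏ i, g (x i) ^ 2) • δ x ∂(Measure.pi fun _ : Fin n => μ)‖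
      ≤ 2 * √(n * ∫ x, (f x - g x) ^ 2 ∂μ) := by
  set ν := Measure.pi fun _ : Fin n => μ
  let F : (Fin n → Ω) → ℝ := fun x => ∏ i, f (x i)
  let G : (Fin n → Ω) → ℝ := fun x => ∏ i, g (x i)
  have hmeas {h : Ω → ℝ} (hh : AEStronglyMeasurable h μ) :
      AEStronglyMeasurable (fun x : Fin n → Ω => ∏ i, h (x i)) ν :=
    Finset.aestronglyMeasurable_fun_prod _ fun i _ =>
      hh.comp_quasiMeasurePreserving (Measure.quasiMeasurePreserving_eval _ i)
  have hF2 : Integrable (fun x => F x ^ 2) ν := by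
    simp only [F, ← Finset.prod_pow]
    exact Integrable.fintype_prod (μ := fun _ => μ) fun _ => hf.integrable_sq
  have hG2 : Integrable (fun x => G x ^ 2) ν := by
    simp only [G, ← Finset.prod_pow]
    exact Integrable.fintype_prod (μ := fun _ => μ) fun _ => hg.integrable_sq
  have hF : MemLp F 2 ν := (memLp_two_iff_integrable_sq (hmeas hf.1)).2 hF2
  have hG : MemLp G 2 ν := (memLp_two_iff_integrable_sq (hmeas hg.1)).2 hG2
  have iF : ∫ x, F x ^ 2 ∂ν = 1 := by
    simp only [F, ← Finset.prod_pow]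
    rw [integral_fintype_prod_eq_pow (fun x => f x ^ 2), hf1, one_pow]
  have iG : ∫ x, G x ^ 2 ∂ν = 1 := by
    simp only [G, ← Finset.prod_pow]
    rw [integral_fintype_prod_eq_pow (fun x => g x ^ 2), hg1, one_pow]
  have iFG : ∫ x, F x * G x ∂ν = (∫ x, f x * g x ∂μ) ^ n := by
    simp only [F, G, ← Finset.prod_mul_distrib]
    rw [integral_fintype_prod_eq_pow (fun x => f x * g x), Fintype.card_fin]
  have hA0 : 0 ≤ ∫ x, f x * g x ∂μ := integral_nonneg fun x => mul_nonneg (hf0 x) (hg0 x)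
  have hm : ∫ x, (f x - g x) ^ 2 ∂μ = 2 - 2 * ∫ x, f x * g x ∂μ := by
    have := integral_add_const_mul_sq hf hg (-1)
    simp only [neg_one_mul, ← sub_eq_add_neg] at this
    rw [this, hf1, hg1]; ring
  have hminus : ∫ x, (F x - G x) ^ 2 ∂ν = 2 - 2 * (∫ x, f x * g x ∂μ) ^ n := by
    have := integral_add_const_mul_sq hF hG (-1)
    simp only [neg_one_mul, ← sub_eq_add_neg] at this
    rw [this, iF, iG, iFG]; ring
  -- Parallelogram identity for two unit vectors.
  have hplus : ∫ x, (F x + G x) ^ 2 ∂ν ≤ 4 := by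
    have h1 := integral_add_const_mul_sq hF hG 1
    have h2 : 0 ≤ ∫ x, (F x - G x) ^ 2 ∂ν := integral_nonneg fun x => sq_nonneg _
    simp only [one_mul] at h1
    rw [hminus] at h2
    rw [h1, iF, iG, iFG]; linarith
  -- Bernoulli's inequality applied to the affinity `∫ f g`: the squared Hellinger distance of the
  -- products is at most `n` times that of the factors.
  have hbern : 2 - 2 * (∫ x, f x * g x ∂μ) ^ n ≤ n * ∫ x, (f x - g x) ^ 2 ∂μ := by
    have := one_add_mul_le_pow (a := ∫ x, f x * g x ∂μ - 1) (by linarith) n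
    rw [add_sub_cancel] at this
    rw [hm]; nlinarith
  have hint {H : (Fin n → Ω) → ℝ} (hH : Integrable (fun x => H x ^ 2) ν) :
      Integrable (fun x => H x ^ 2 • δ x) ν := by
    refine hH.norm.mono (hH.1.smul hδ) (Eventually.of_forall fun x => ?_)
    rw [norm_smul, norm_norm]
    exact mul_le_of_le_one_right (norm_nonneg _) (hδ1 x)
  simp only [Finset.prod_pow]
  calc ‖∫ x, F x ^ 2 • δ x ∂ν - ∫ x, G x ^ 2 • δ x ∂ν‖
      = ‖∫ x, (F x ^ 2 • δ x - G x ^ 2 • δ x) ∂ν‖ := by rw [integral_sub (hint hF2) (hint hG2)]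
    _ ≤ ∫ x, |F x - G x| * |F x + G x| ∂ν := by
        refine norm_integral_le_of_norm_le
          (MemLp.integrable_mul (hF.sub hG).abs (hF.add hG).abs) (Eventually.of_forall fun x => ?_)
        rw [← sub_smul, norm_smul, ← abs_mul, Real.norm_eq_abs]
        refine (mul_le_of_le_one_right (abs_nonneg _) (hδ1 x)).trans_eq ?_
        congr 1; ring
    _ ≤ √(∫ x, (F x - G x) ^ 2 ∂ν) * √(∫ x, (F x + G x) ^ 2 ∂ν) :=
        integral_abs_mul_le_sqrt_mul_sqrt (hF.sub hG) (hF.add hG)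
    _ ≤ √(n * ∫ x, (f x - g x) ^ 2 ∂μ) * √4 := by
        gcongr
        exact hminus.trans_le hbern
    _ = 2 * √(n * ∫ x, (f x - g x) ^ 2 ∂μ) := by
        rw [show (4 : ℝ) = 2 ^ 2 by norm_num, Real.sqrt_sq (by norm_num)]; ring

/-- The approximating root `g` need not have norm one. Normalizing it costs little: for a unit
vector `f`, `‖f - g‖² - ‖g‖ ‖f - g/‖g‖‖² = (‖g‖ - 1)² ≥ 0`. -/
theorem norm_integral_pi_withDensity_sub_le {Ω E : Type*} [MeasurableSpace Ω]
    [NormedAddCommGroup E] [NormedSpace ℝ E] {μ : Measure Ω} [SigmaFinite μ] (n : ℕ) {f g : Ω → ℝ}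
    (hfm : Measurable f) (hgm : Measurable g)
    (hf : MemLp f 2 μ) (hg : MemLp g 2 μ) (hf0 : ∀ x, 0 ≤ f x) (hg0 : ∀ x, 0 ≤ g x)
    (hf1 : ∫ x, f x ^ 2 ∂μ = 1) (hg1 : 0 < ∫ x, g x ^ 2 ∂μ)
    {δ : (Fin n → Ω) → E} (hδ : StronglyMeasurable δ) (hδ1 : ∀ x, ‖δ x‖ ≤ 1) :
    ‖∫ x, δ x ∂Measure.pi (fun _ : Fin n => μ.withDensity fun x => ENNReal.ofReal (f x ^ 2))
      - ∫ x, δ x ∂Measure.pi (fun _ : Fin n => μ.withDensity fun x =>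
        ENNReal.ofReal (g x ^ 2 / ∫ x, g x ^ 2 ∂μ))‖
      ≤ 2 * √(n * ((∫ x, (f x - g x) ^ 2 ∂μ) / √(∫ x, g x ^ 2 ∂μ))) := by
  set M := ∫ x, g x ^ 2 ∂μ with hM
  have hm : 0 < √M := Real.sqrt_pos.2 hg1
  have hmM : √M ^ 2 = M := Real.sq_sqrt hg1.le
  have hgd (x : Ω) : g x ^ 2 / M = (g x / √M) ^ 2 := by rw [div_pow, hmM]
  simp_rw [hgd]
  have hg' : MemLp (fun x => g x / √M) 2 μ := by
    simpa [div_eq_inv_mul] using hg.const_mul (√M)⁻¹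
  rw [integral_pi_withDensity_ofReal n (hfm.pow_const 2) (fun x => sq_nonneg _) hf.integrable_sq,
    integral_pi_withDensity_ofReal n ((hgm.div_const _).pow_const 2) (fun x => sq_nonneg _)
      hg'.integrable_sq]
  refine (norm_integral_prod_sq_sub_le n hf hg' hf0 (fun x => div_nonneg (hg0 x) hm.le) hf1 ?_
    hδ.aestronglyMeasurable hδ1).trans ?_
  · simp_rw [← hgd, integral_div]
    exact div_self hg1.ne'
  · gcongr
    rw [le_div_iff₀ hm]
    have e1 : ∫ x, (f x - g x) ^ 2 ∂μ = 1 + M - 2 * ∫ x, f x * g x ∂μ := by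
      have := integral_add_const_mul_sq hf hg (-1)
      simp only [neg_one_mul, ← sub_eq_add_neg] at this
      rw [this, hf1, ← hM]; ring
    have e2 : ∫ x, (f x - g x / √M) ^ 2 ∂μ = 2 - 2 / √M * ∫ x, f x * g x ∂μ := by
      have := integral_add_const_mul_sq hf hg (-(1 / √M))
      simp only [neg_mul, ← sub_eq_add_neg, one_div_mul_eq_div] at this
      rw [this, hf1, ← hM, neg_sq, div_pow, hmM]
      field_simp
      ring
    rw [e1, e2]
    have : (2 - 2 / √M * ∫ x, f x * g x ∂μ) * √M = 2 * √M - 2 * ∫ x, f x * g x ∂μ := by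
      field_simp
    rw [this]
    nlinarith [sq_nonneg (√M - 1)]

/-! ### Truncated exponential tilts -/

/-- The exponential tilt `exp (ρ/√n)`, truncated to `{b ≤ √n}`. -/
noncomputable def truncTilt {Ω : Type*} (ρ b : Ω → ℝ) (n : ℕ) : Ω → ℝ :=
  {x | b x ≤ √(n : ℝ)}.indicator fun x => Real.exp (ρ x / √(n : ℝ))

/-- The normalizing constant of the truncated exponential tilt. -/
noncomputable def tiltMass {Ω : Type*} [MeasurableSpace Ω] (P : Measure Ω) (ρ b : Ω → ℝ) (n : ℕ) :
    ℝ :=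
  ∫ x, truncTilt ρ b n x ∂P

/-- The measure with density proportional to the truncated exponential tilt. -/
noncomputable def tiltMeasure {Ω : Type*} [MeasurableSpace Ω] (P : Measure Ω) (ρ b : Ω → ℝ)
    (n : ℕ) : Measure Ω :=
  P.withDensity fun x => ENNReal.ofReal (truncTilt ρ b n x / tiltMass P ρ b n)

section

variable {Ω : Type*} {ρ b : Ω → ℝ}

theorem truncTilt_nonneg (n : ℕ) (x : Ω) : 0 ≤ truncTilt ρ b n x :=
  indicator_nonneg (fun _ _ => (Real.exp_pos _).le) _

/-- The tilt by `ρ/2` with the same cut-off is thus the square root density of the tilt by `ρ`, up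
to normalization. -/
theorem truncTilt_half_sq (n : ℕ) (x : Ω) :
    truncTilt (fun x => ρ x / 2) b n x ^ 2 = truncTilt ρ b n x := by
  by_cases hx : x ∈ {x | b x ≤ √(n : ℝ)}
  · simp only [truncTilt, indicator_of_mem hx]
    rw [← Real.exp_nat_mul]
    congr 1
    push_cast
    ring
  · simp [truncTilt, indicator_of_notMem hx]

theorem truncTilt_le (hρb : ∀ x, |ρ x| ≤ b x) {n : ℕ} (hn : 1 ≤ n) (x : Ω) :
    truncTilt ρ b n x ≤ Real.exp 1 := by
  have hs : (0 : ℝ) < √(n : ℝ) := Real.sqrt_pos.2 (by exact_mod_cast hn)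
  refine indicator_apply_le' (fun hx => Real.exp_le_exp.2 ?_) fun _ => (Real.exp_pos _).le
  rw [div_le_one hs]
  exact (le_abs_self _).trans ((hρb x).trans hx)

theorem ofReal_truncTilt (n : ℕ) (x : Ω) : ((truncTilt ρ b n x : ℝ) : ℂ)
    = {x | b x ≤ √(n : ℝ)}.indicator (fun x => Complex.exp ((ρ x : ℂ) / (√(n : ℝ) : ℝ))) x := by
  by_cases hx : x ∈ {x | b x ≤ √(n : ℝ)}
  · simp only [truncTilt, indicator_of_mem hx]
    push_cast
    rfl
  · simp [truncTilt, indicator_of_notMem hx]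

variable [MeasurableSpace Ω] {P : Measure Ω}

theorem measurable_truncTilt (hρ : Measurable ρ) (hb : Measurable b) (n : ℕ) :
    Measurable (truncTilt ρ b n) :=
  ((hρ.div_const _).exp).indicator (measurableSet_le hb measurable_const)

theorem integrable_truncTilt [IsFiniteMeasure P] (hρ : Measurable ρ) (hb : Measurable b)
    (hρb : ∀ x, |ρ x| ≤ b x) {n : ℕ} (hn : 1 ≤ n) : Integrable (truncTilt ρ b n) P :=
  (integrable_const (Real.exp 1)).mono' (measurable_truncTilt hρ hb n).aestronglyMeasurable
    (Eventually.of_forall fun x => by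
      rw [Real.norm_of_nonneg (truncTilt_nonneg n x)]; exact truncTilt_le hρb hn x)

theorem tendsto_nat_mul_tiltMass_sub_one [IsProbabilityMeasure P] (hρ : Measurable ρ)
    (hb : Measurable b) (hbL : MemLp b 2 P) (hρb : ∀ x, |ρ x| ≤ b x) (hρ0 : ∫ x, ρ x ∂P = 0) :
    Tendsto (fun n : ℕ => (n : ℝ) * (tiltMass P ρ b n - 1)) atTop (𝓝 (∫ x, ρ x ^ 2 / 2 ∂P)) := by
  have h := tendsto_nat_mul_integral_trunc_exp_sub_one (P := P) (z := fun x => (ρ x : ℂ)) (b := b)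
    (C := 1) (by fun_prop) hb hbL zero_le_one (fun x => by simpa using hρb x)
    (by rw [integral_complex_ofReal, hρ0]; simp)
  simp_rw [← ofReal_truncTilt, integral_complex_ofReal] at h
  have h2 : ∫ x, (ρ x : ℂ) ^ 2 / 2 ∂P = ((∫ x, ρ x ^ 2 / 2 ∂P : ℝ) : ℂ) := by
    rw [← integral_complex_ofReal]; push_cast; rfl
  rw [h2] at h
  have := (Complex.continuous_re.tendsto _).comp h
  simp only [Function.comp_def, Complex.ofReal_re] at this
  refine this.congr fun n => ?_
  rw [tiltMass, ← Complex.ofReal_re (_ * _)]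
  push_cast
  rfl

theorem tendsto_tiltMass [IsProbabilityMeasure P] (hρ : Measurable ρ)
    (hb : Measurable b) (hbL : MemLp b 2 P) (hρb : ∀ x, |ρ x| ≤ b x) (hρ0 : ∫ x, ρ x ∂P = 0) :
    Tendsto (tiltMass P ρ b) atTop (𝓝 1) := by
  have h := (tendsto_nat_mul_tiltMass_sub_one hρ hb hbL hρb hρ0).mul
    tendsto_inv_atTop_nhds_zero_nat
  rw [mul_zero] at h
  have h2 : Tendsto (fun n => tiltMass P ρ b n - 1) atTop (𝓝 0) := by
    refine h.congr' ?_
    filter_upwards [eventually_ge_atTop 1] with n hn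
    have : (n : ℝ) ≠ 0 := by positivity
    field_simp
  simpa using h2.add_const 1

theorem tendsto_tiltMass_pow [IsProbabilityMeasure P] (hρ : Measurable ρ)
    (hb : Measurable b) (hbL : MemLp b 2 P) (hρb : ∀ x, |ρ x| ≤ b x) (hρ0 : ∫ x, ρ x ∂P = 0) :
    Tendsto (fun n => tiltMass P ρ b n ^ n) atTop (𝓝 (Real.exp (∫ x, ρ x ^ 2 / 2 ∂P))) := by
  simpa using Real.tendsto_one_add_pow_exp_of_tendsto
    (tendsto_nat_mul_tiltMass_sub_one hρ hb hbL hρb hρ0)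

/-- The root `exp(ρ/(2√n))` has first order part `1 + ρ/(2√n)`, the expansion prescribed for local
alternatives; the error is `o(1/√n)` in `L₂(P)` by dominated convergence, although `ρ` has only two
moments. -/
theorem tendsto_nat_mul_integral_sub_truncTilt_sq [IsProbabilityMeasure P] (hρ : Measurable ρ)
    (hb : Measurable b) (hbL : MemLp b 2 P) (hρb : ∀ x, |ρ x| ≤ b x) :
    Tendsto (fun n : ℕ => (n : ℝ) * ∫ x, (1 + 1 / √(n : ℝ) / 2 * ρ x
      - truncTilt (fun x => ρ x / 2) b n x) ^ 2 ∂P) atTop (𝓝 0) := by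
  simp_rw [← integral_const_mul]
  rw [← integral_zero Ω ℝ (μ := P)]
  have hw (n : ℕ) (x : Ω) : 1 / √(n : ℝ) / 2 * ρ x = ρ x / 2 / √(n : ℝ) := by ring
  have hsq : Tendsto (fun n : ℕ => √(n : ℝ)) atTop atTop :=
    Real.tendsto_sqrt_atTop.comp tendsto_natCast_atTop_atTop
  -- The quadratic Taylor bound `w²` at `w = ρ/(2√n)`, squared and multiplied by `n`, gives
  -- `(ρ/2)⁴/n`. It vanishes pointwise, and `b² ≤ n` bounds it by an integrable function.
  have hin {n : ℕ} {x : Ω} (hn : 1 ≤ n) (hx : b x ≤ √(n : ℝ)) :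
      (n : ℝ) * (1 + 1 / √(n : ℝ) / 2 * ρ x - truncTilt (fun x => ρ x / 2) b n x) ^ 2
        ≤ (ρ x / 2) ^ 4 / n ∧ (ρ x / 2) ^ 4 / n ≤ b x ^ 2 := by
    have hs : (0 : ℝ) < √(n : ℝ) := Real.sqrt_pos.2 (by exact_mod_cast hn)
    have hss : (n : ℝ) = √(n : ℝ) ^ 2 := (Real.sq_sqrt (Nat.cast_nonneg n)).symm
    have hn0 : (0 : ℝ) < n := by exact_mod_cast hn
    have hv : truncTilt (fun x => ρ x / 2) b n x = Real.exp (ρ x / 2 / √(n : ℝ)) :=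
      indicator_of_mem (s := {x | b x ≤ √(n : ℝ)}) hx _
    have hρx := hρb x
    have hb0 : 0 ≤ b x := (abs_nonneg _).trans hρx
    have hρ2 : (ρ x) ^ 2 ≤ b x ^ 2 := sq_le_sq' (by linarith [neg_abs_le (ρ x)])
      ((le_abs_self _).trans hρx)
    have hb2 : b x ^ 2 ≤ n := by rw [hss]; exact pow_le_pow_left₀ hb0 hx 2
    have hwn : ‖ρ x / 2 / √(n : ℝ)‖ ≤ 1 := by
      rw [Real.norm_eq_abs, abs_div, abs_div, abs_of_pos hs, div_le_one hs]
      norm_num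
      linarith [abs_nonneg (ρ x)]
    have hexp := Real.norm_exp_sub_one_sub_id_le hwn
    refine ⟨?_, ?_⟩
    · rw [hw, hv]
      have h1 : (1 + ρ x / 2 / √(n : ℝ) - Real.exp (ρ x / 2 / √(n : ℝ))) ^ 2
          ≤ (‖ρ x / 2 / √(n : ℝ)‖ ^ 2) ^ 2 := by
        have h2 : (1 + ρ x / 2 / √(n : ℝ) - Real.exp (ρ x / 2 / √(n : ℝ)))
            = -(Real.exp (ρ x / 2 / √(n : ℝ)) - 1 - ρ x / 2 / √(n : ℝ)) := by ring
        rw [h2, neg_sq, ← sq_abs]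
        exact pow_le_pow_left₀ (abs_nonneg _) hexp 2
      calc _ ≤ (n : ℝ) * (‖ρ x / 2 / √(n : ℝ)‖ ^ 2) ^ 2 := by gcongr
        _ = (ρ x / 2) ^ 4 / n := by
          rw [Real.norm_eq_abs, sq_abs, div_pow _ (√(n : ℝ)), ← hss]
          field_simp
    · rw [div_le_iff₀ hn0]
      have : (ρ x / 2) ^ 4 = ρ x ^ 2 * ρ x ^ 2 / 16 := by ring
      rw [this]
      nlinarith [sq_nonneg (ρ x), sq_nonneg (b x), mul_le_mul hρ2 hρ2 (sq_nonneg _) (sq_nonneg _)]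
  refine tendsto_integral_filter_of_dominated_convergence (fun x => 3 * b x ^ 2) ?_ ?_
    (hbL.integrable_sq.const_mul _) ?_
  · refine Eventually.of_forall fun n => Measurable.aestronglyMeasurable ?_
    exact ((((hρ.const_mul _).const_add 1).sub
      (measurable_truncTilt (hρ.div_const 2) hb n)).pow_const 2).const_mul _
  · filter_upwards [eventually_ge_atTop 1] with n hn
    refine Eventually.of_forall fun x => ?_
    rw [Real.norm_of_nonneg (by positivity)]
    by_cases hx : b x ≤ √(n : ℝ)
    · exact ((hin hn hx).1.trans (hin hn hx).2).trans (by nlinarith [sq_nonneg (b x)])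
    · have hv : truncTilt (fun x => ρ x / 2) b n x = 0 :=
        indicator_of_notMem (s := {x | b x ≤ √(n : ℝ)}) hx _
      have hs : (0 : ℝ) < √(n : ℝ) := Real.sqrt_pos.2 (by exact_mod_cast hn)
      have hss : (n : ℝ) = √(n : ℝ) ^ 2 := (Real.sq_sqrt (Nat.cast_nonneg n)).symm
      -- Beyond the cut-off `√n < b`, so this square is at most `(3b/2)² ≤ 3b²`.
      have h1 : (n : ℝ) * (1 + 1 / √(n : ℝ) / 2 * ρ x - 0) ^ 2 = (√(n : ℝ) + ρ x / 2) ^ 2 := by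
        nth_rw 1 [hss]
        rw [← mul_pow]
        congr 1
        field_simp
        ring
      rw [hv, h1]
      push Not at hx
      obtain ⟨h3, h4⟩ := abs_le.1 (hρb x)
      nlinarith
  · refine Eventually.of_forall fun x => ?_
    have hlim : Tendsto (fun n : ℕ => (ρ x / 2) ^ 4 / (n : ℝ)) atTop (𝓝 0) :=
      tendsto_const_div_atTop_nhds_zero_nat _
    refine squeeze_zero' (Eventually.of_forall fun n => by positivity) ?_ hlim
    filter_upwards [eventually_ge_atTop 1, hsq.eventually_ge_atTop (b x)] with n hn hx
    exact (hin hn hx).1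

/-! ### Square root densities, and replacing local alternatives by tilts -/

theorem memLp_sqrt_rnDeriv (P μ : Measure Ω) [IsFiniteMeasure P] :
    MemLp (fun x => √((P.rnDeriv μ x).toReal)) 2 μ := by
  rw [memLp_two_iff_integrable_sq
    (P.measurable_rnDeriv μ).ennreal_toReal.sqrt.aestronglyMeasurable]
  simp_rw [Real.sq_sqrt ENNReal.toReal_nonneg]
  exact Measure.integrable_toReal_rnDeriv

theorem integral_mul_sqrt_rnDeriv_sq {μ : Measure Ω} [SigmaFinite μ] [IsFiniteMeasure P]
    (hPμ : P ≪ μ) (u : Ω → ℝ) :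
    ∫ x, (u x * √((P.rnDeriv μ x).toReal)) ^ 2 ∂μ = ∫ x, u x ^ 2 ∂P := by
  rw [← integral_toReal_rnDeriv_mul hPμ]
  congr 1 with x
  rw [mul_pow, Real.sq_sqrt ENNReal.toReal_nonneg, mul_comm]

theorem memLp_mul_sqrt_rnDeriv {μ : Measure Ω} [SigmaFinite μ] [IsFiniteMeasure P]
    (hPμ : P ≪ μ) {u : Ω → ℝ} (hu : Measurable u) (huL : MemLp u 2 P) :
    MemLp (fun x => u x * √((P.rnDeriv μ x).toReal)) 2 μ := by
  have hm : Measurable fun x => u x * √((P.rnDeriv μ x).toReal) :=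
    hu.mul (P.measurable_rnDeriv μ).ennreal_toReal.sqrt
  rw [memLp_two_iff_integrable_sq hm.aestronglyMeasurable]
  have := (integrable_toReal_rnDeriv_mul_iff hPμ).2 huL.integrable_sq
  refine this.congr (Eventually.of_forall fun x => ?_)
  simp only
  rw [mul_pow, Real.sq_sqrt ENNReal.toReal_nonneg, mul_comm]

theorem withDensity_sqrt_rnDeriv_sq {μ : Measure Ω} [SigmaFinite μ] [IsFiniteMeasure P]
    (hPμ : P ≪ μ) :
    μ.withDensity (fun x => ENNReal.ofReal (√((P.rnDeriv μ x).toReal) ^ 2)) = P := by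
  nth_rw 2 [← Measure.withDensity_rnDeriv_eq P μ hPμ]
  refine withDensity_congr_ae ?_
  filter_upwards [P.rnDeriv_lt_top μ] with x hx
  rw [Real.sq_sqrt ENNReal.toReal_nonneg, ENNReal.ofReal_toReal hx.ne]

theorem withDensity_mul_sqrt_rnDeriv_sq {μ : Measure Ω} [SigmaFinite μ] [IsFiniteMeasure P]
    (hPμ : P ≪ μ) {u : Ω → ℝ} (hu : Measurable u) (c : ℝ) :
    μ.withDensity (fun x => ENNReal.ofReal ((u x * √((P.rnDeriv μ x).toReal)) ^ 2 / c))
      = P.withDensity fun x => ENNReal.ofReal (u x ^ 2 / c) := by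
  nth_rw 2 [← withDensity_sqrt_rnDeriv_sq hPμ]
  rw [← withDensity_mul]
  · congr 1 with x
    rw [Pi.mul_apply, ← ENNReal.ofReal_mul (sq_nonneg _)]
    congr 1
    ring
  · exact ((P.measurable_rnDeriv μ).ennreal_toReal.sqrt.pow_const 2).ennreal_ofReal
  · exact ((hu.pow_const 2).div_const c).ennreal_ofReal

theorem memLp_rootRemainder [IsFiniteMeasure P] {Q : Measure Ω} [IsFiniteMeasure Q]
    (hρ : Measurable ρ) (hρL : MemLp ρ 2 P) (s : ℝ) : MemLp (rootRemainder P Q ρ s) 2 (P + Q) := by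
  have hac : P ≪ P + Q := Measure.absolutelyContinuous_of_le (Measure.le_add_right le_rfl)
  have h1 : MemLp (fun x => 1 + s / 2 * ρ x) 2 P := (memLp_const (1 : ℝ)).add (hρL.const_mul (s / 2))
  have h2 : Measurable fun x => 1 + s / 2 * ρ x := (hρ.const_mul _).const_add 1
  exact (memLp_sqrt_rnDeriv Q (P + Q)).sub (memLp_mul_sqrt_rnDeriv hac h2 h1)

theorem IsLocalAlternative.tendsto_integral_rootRemainder_sq [IsProbabilityMeasure P]
    {ρ : Lp ℝ 2 P} {Q : ℕ → ProbabilityMeasure Ω} (hQ : IsLocalAlternative P ρ Q) :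
    Tendsto (fun n : ℕ => (n : ℝ) * ∫ x, rootRemainder P (Q n : Measure Ω) ρ (1 / √(n : ℝ)) x ^ 2
      ∂(P + (Q n : Measure Ω))) atTop (𝓝 0) := by
  have h := (ENNReal.continuousAt_toReal ENNReal.zero_ne_top).tendsto.comp hQ
  have h2 := h.pow 2
  simp only [ENNReal.toReal_zero, zero_pow two_ne_zero, Function.comp_def] at h2
  refine h2.congr fun n => ?_
  have hm := memLp_rootRemainder (P := P) (Q := (Q n : Measure Ω))
    (Lp.stronglyMeasurable ρ).measurable (Lp.memLp ρ) (1 / √(n : ℝ))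
  rw [hm.eLpNorm_eq_integral_rpow_norm two_ne_zero ENNReal.ofNat_ne_top, ENNReal.toReal_mul,
    ENNReal.toReal_ofReal (Real.sqrt_nonneg _), ENNReal.toReal_ofReal (by positivity), mul_pow,
    Real.sq_sqrt (Nat.cast_nonneg n)]
  congr 1
  simp only [ENNReal.toReal_ofNat, Real.rpow_two, Real.norm_eq_abs, sq_abs]
  rw [← Real.rpow_natCast, ← Real.rpow_mul (by positivity)]
  simp

/-- The local alternatives are asymptotically indistinguishable from the truncated tilts. -/
theorem IsLocalAlternative.tendsto_integral_pi_sub_tiltMeasure [IsProbabilityMeasure P]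
    {ρ : Lp ℝ 2 P} {Q : ℕ → ProbabilityMeasure Ω} (hQ : IsLocalAlternative P ρ Q)
    (hb : Measurable b) (hbL : MemLp b 2 P) (hρb : ∀ x, |ρ x| ≤ b x) (hρ0 : ∫ x, ρ x ∂P = 0)
    {E : Type*} [NormedAddCommGroup E] [NormedSpace ℝ E]
    {δ : (n : ℕ) → (Fin n → Ω) → E} (hδ : ∀ n, StronglyMeasurable (δ n))
    (hδ1 : ∀ n x, ‖δ n x‖ ≤ 1) :
    Tendsto (fun n => ∫ x, δ n x ∂Measure.pi (fun _ : Fin n => (Q n : Measure Ω))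
      - ∫ x, δ n x ∂Measure.pi (fun _ : Fin n => tiltMeasure P ρ b n)) atTop (𝓝 0) := by
  have hρ : Measurable ρ := (Lp.stronglyMeasurable ρ).measurable
  let v : ℕ → Ω → ℝ := truncTilt (fun x => ρ x / 2) b
  have hvm (n : ℕ) : Measurable (v n) := measurable_truncTilt (hρ.div_const 2) hb n
  let u : ℕ → Ω → ℝ := fun n x => 1 + 1 / √(n : ℝ) / 2 * ρ x - v n x
  let μ : ℕ → Measure Ω := fun n => P + (Q n : Measure Ω)
  let r : ℕ → Ω → ℝ := fun n => rootRemainder P (Q n : Measure Ω) ρ (1 / √(n : ℝ))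
  have hM := tendsto_tiltMass hρ hb hbL hρb hρ0
  have hlim : Tendsto (fun n : ℕ => 2 * √((2 * (n * ∫ x, r n x ^ 2 ∂μ n)
      + 2 * (n * ∫ x, u n x ^ 2 ∂P)) / √(tiltMass P ρ b n))) atTop (𝓝 0) := by
    have h1 := hQ.tendsto_integral_rootRemainder_sq.const_mul 2
    have h2 := (tendsto_nat_mul_integral_sub_truncTilt_sq hρ hb hbL hρb).const_mul 2
    have h3 := (((h1.add h2).div hM.sqrt (by simp)).sqrt.const_mul 2)
    simp only [mul_zero, add_zero, zero_div, Real.sqrt_zero] at h3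
    exact h3
  refine squeeze_zero_norm' ?_ hlim
  filter_upwards [eventually_ge_atTop 1, hM.eventually (lt_mem_nhds zero_lt_one)] with n hn hMn
  have hP : P ≪ μ n := Measure.absolutelyContinuous_of_le (Measure.le_add_right le_rfl)
  have hQn : (Q n : Measure Ω) ≪ μ n := Measure.absolutelyContinuous_of_le (Measure.le_add_left le_rfl)
  have hvL : MemLp (v n) 2 P := by
    rw [memLp_two_iff_integrable_sq (hvm n).aestronglyMeasurable]
    simp_rw [v, truncTilt_half_sq]
    exact integrable_truncTilt hρ hb hρb hn
  have huL : MemLp (u n) 2 P :=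
    ((memLp_const (1 : ℝ)).add ((Lp.memLp ρ).const_mul (1 / √(n : ℝ) / 2))).sub hvL
  have hum : Measurable (u n) := ((hρ.const_mul _).const_add 1).sub (hvm n)
  have hg2 : ∫ x, (v n x * √((P.rnDeriv (μ n) x).toReal)) ^ 2 ∂μ n = tiltMass P ρ b n := by
    rw [integral_mul_sqrt_rnDeriv_sq hP]
    simp_rw [v, truncTilt_half_sq]
    rfl
  have key := norm_integral_pi_withDensity_sub_le (μ := μ n) n
    (f := fun x => √(((Q n : Measure Ω).rnDeriv (μ n) x).toReal))
    (g := fun x => v n x * √((P.rnDeriv (μ n) x).toReal))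
    ((Q n : Measure Ω).measurable_rnDeriv (μ n)).ennreal_toReal.sqrt
    ((hvm n).mul (P.measurable_rnDeriv (μ n)).ennreal_toReal.sqrt)
    (memLp_sqrt_rnDeriv _ _) (memLp_mul_sqrt_rnDeriv hP (hvm n) hvL)
    (fun x => Real.sqrt_nonneg _) (fun x => mul_nonneg (truncTilt_nonneg _ _) (Real.sqrt_nonneg _))
    (by
      simp_rw [Real.sq_sqrt ENNReal.toReal_nonneg]
      rw [Measure.integral_toReal_rnDeriv hQn]
      simp)
    (by rw [hg2]; exact hMn) (hδ n) (hδ1 n)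
  rw [withDensity_sqrt_rnDeriv_sq hQn, hg2, withDensity_mul_sqrt_rnDeriv_sq hP (hvm n)]
    at key
  have hT : (P.withDensity fun x => ENNReal.ofReal (v n x ^ 2 / tiltMass P ρ b n))
      = tiltMeasure P ρ b n := by
    simp_rw [v, truncTilt_half_sq]
    rfl
  rw [hT] at key
  refine key.trans ?_
  rw [← mul_div_assoc]
  gcongr
  have hrm : MemLp (r n) 2 (μ n) := memLp_rootRemainder hρ (Lp.memLp ρ) _
  have hup := memLp_mul_sqrt_rnDeriv hP hum huL
  rw [← integral_mul_sqrt_rnDeriv_sq hP, mul_left_comm 2, mul_left_comm 2, ← mul_add,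
    ← integral_const_mul 2, ← integral_const_mul 2,
    ← integral_add (hrm.integrable_sq.const_mul _) (hup.integrable_sq.const_mul _)]
  refine mul_le_mul_of_nonneg_left (integral_mono ?_ ?_ ?_) (Nat.cast_nonneg n)
  · exact ((memLp_sqrt_rnDeriv _ _).sub (memLp_mul_sqrt_rnDeriv hP (hvm n) hvL)).integrable_sq
  · exact (hrm.integrable_sq.const_mul _).add (hup.integrable_sq.const_mul _)
  · intro x
    -- The Hellinger error splits into the remainder of the local alternative and that of the tilt;
    -- `(r + a)² ≤ 2r² + 2a²` accounts for the factors two.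
    have : √(((Q n : Measure Ω).rnDeriv (μ n) x).toReal) - v n x * √((P.rnDeriv (μ n) x).toReal)
        = r n x + u n x * √((P.rnDeriv (μ n) x).toReal) := by
      simp only [r, u, rootRemainder, μ]; ring
    simp only
    rw [this]
    nlinarith [sq_nonneg (r n x - u n x * √((P.rnDeriv (μ n) x).toReal))]

end

/-! ### Asymptotic normality under local alternatives -/

section

variable {Ω : Type*} [MeasurableSpace Ω] {P : Measure Ω} {ρ b : Ω → ℝ}

/-- Real tilt and oscillating factor merge into a single complex exponent, to which the truncated
expansion under `P` applies. -/
theorem integral_cexp_tiltMeasure (hρ : Measurable ρ) (hb : Measurable b) (h : Ω → ℝ) (n : ℕ)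
    (hM : 0 ≤ tiltMass P ρ b n) (t : ℝ) :
    ∫ x, Complex.exp (t * h x / (√(n : ℝ) : ℝ) * Complex.I) ∂tiltMeasure P ρ b n
      = (∫ x, {x | b x ≤ √(n : ℝ)}.indicator
          (fun x => Complex.exp ((ρ x + t * h x * Complex.I) / (√(n : ℝ) : ℝ))) x ∂P)
        / tiltMass P ρ b n := by
  rw [tiltMeasure, integral_withDensity_eq_integral_toReal_smul
    ((measurable_truncTilt hρ hb n).div_const _).ennreal_ofReal
    (Eventually.of_forall fun _ => ENNReal.ofReal_lt_top), ← integral_div]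
  congr 1 with x
  rw [ENNReal.toReal_ofReal (div_nonneg (truncTilt_nonneg n x) hM), Complex.real_smul,
    Complex.ofReal_div, ofReal_truncTilt]
  by_cases hx : x ∈ {x | b x ≤ √(n : ℝ)}
  · simp only [indicator_of_mem hx]
    rw [div_mul_eq_mul_div, ← Complex.exp_add]
    congr 2
    ring
  · simp [indicator_of_notMem hx]

/-- Asymptotic normality under the truncated tilts, in terms of characteristic functions. -/
theorem tendsto_integral_cexp_pi_tiltMeasure [IsProbabilityMeasure P] (hρ : Measurable ρ)
    (hb : Measurable b) (hbL : MemLp b 2 P) (hρb : ∀ x, |ρ x| ≤ b x) (hρ0 : ∫ x, ρ x ∂P = 0)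
    {h : Ω → ℝ} (hh : Measurable h) (hhb : ∀ x, |h x| ≤ b x) (hh0 : ∫ x, h x ∂P = 0) (t : ℝ) :
    Tendsto (fun n : ℕ => ∫ x, Complex.exp (t * (1 / √(n : ℝ) * ∑ i, h (x i) : ℝ) * Complex.I)
        ∂Measure.pi (fun _ : Fin n => tiltMeasure P ρ b n)) atTop
      (𝓝 (Complex.exp (t * (∫ x, h x * ρ x ∂P : ℝ) * Complex.I
        - (∫ x, h x ^ 2 ∂P : ℝ) * t ^ 2 / 2))) := by
  have hL {f : Ω → ℝ} (hf : Measurable f) (hfb : ∀ x, |f x| ≤ b x) : MemLp f 2 P :=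
    hbL.mono hf.aestronglyMeasurable (Eventually.of_forall fun x => (hfb x).trans (le_abs_self _))
  have hρL := hL hρ hρb
  have hhL := hL hh hhb
  have hM := tendsto_tiltMass hρ hb hbL hρb hρ0
  have h1 := tendsto_integral_trunc_exp_pow (P := P) (b := b) (C := 1 + |t|)
    (z := fun x => ρ x + t * h x * Complex.I) (by fun_prop) hb hbL (by positivity)
    (fun x => by
      refine (norm_add_le _ _).trans ?_
      simp only [norm_mul, Complex.norm_real, Complex.norm_I, mul_one, Real.norm_eq_abs]
      nlinarith [hρb x, mul_le_mul_of_nonneg_left (hhb x) (abs_nonneg t)])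
    (by
      rw [integral_add (hρL.integrable one_le_two).ofReal
        (((hhL.integrable one_le_two).ofReal.const_mul _).mul_const _),
        integral_mul_const, integral_const_mul, integral_complex_ofReal, integral_complex_ofReal,
        hρ0, hh0]
      simp)
  have h2 := (Complex.continuous_ofReal.tendsto _).comp (tendsto_tiltMass_pow hρ hb hbL hρb hρ0)
  have h3 := h1.div h2 (by simp)
  -- Expanding the square: the `ρ²/2` term is cancelled by the limit of the normalizing constants,
  -- the cross term is the mean shift, and the last term is the Gaussian variance.
  have hlim : ∫ x, ((ρ x : ℂ) + t * h x * Complex.I) ^ 2 / 2 ∂P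
      = (∫ x, ρ x ^ 2 / 2 ∂P : ℝ) + (t * (∫ x, h x * ρ x ∂P : ℝ) * Complex.I
        - (∫ x, h x ^ 2 ∂P : ℝ) * t ^ 2 / 2) := by
    have i1 : Integrable (fun x => ((ρ x ^ 2 / 2 : ℝ) : ℂ)) P :=
      (hρL.integrable_sq.div_const 2).ofReal
    have i2 : Integrable (fun x => (t * Complex.I) * ((h x * ρ x : ℝ) : ℂ)) P :=
      (show Integrable (fun x => h x * ρ x) P from hhL.integrable_mul hρL).ofReal.const_mul _
    have i3 : Integrable (fun x => (t ^ 2 / 2 : ℂ) * ((h x ^ 2 : ℝ) : ℂ)) P :=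
      hhL.integrable_sq.ofReal.const_mul _
    have i23 : Integrable (fun x => (t * Complex.I) * ((h x * ρ x : ℝ) : ℂ)
        - (t ^ 2 / 2 : ℂ) * ((h x ^ 2 : ℝ) : ℂ)) P := i2.sub i3
    have e : ∀ x, ((ρ x : ℂ) + t * h x * Complex.I) ^ 2 / 2 = ((ρ x ^ 2 / 2 : ℝ) : ℂ)
        + ((t * Complex.I) * ((h x * ρ x : ℝ) : ℂ) - (t ^ 2 / 2 : ℂ) * ((h x ^ 2 : ℝ) : ℂ)) := by
      intro x
      push_cast
      linear_combination ((t : ℂ) ^ 2 * (h x : ℂ) ^ 2 / 2) * Complex.I_sq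
    simp_rw [e]
    rw [integral_add i1 i23, integral_sub i2 i3, integral_const_mul, integral_const_mul,
      integral_complex_ofReal, integral_complex_ofReal, integral_complex_ofReal]
    ring
  rw [hlim, Complex.ofReal_exp, ← Complex.exp_sub, add_sub_cancel_left] at h3
  refine h3.congr' ?_
  filter_upwards [eventually_ge_atTop 1, hM.eventually (lt_mem_nhds zero_lt_one)] with n hn hMn
  have hfin : IsFiniteMeasure (tiltMeasure P ρ b n) :=
    isFiniteMeasure_withDensity_ofReal ((integrable_truncTilt hρ hb hρb hn).div_const _).2
  have e (x : Fin n → Ω) : Complex.exp (t * (1 / √(n : ℝ) * ∑ i, h (x i) : ℝ) * Complex.I)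
      = ∏ i, Complex.exp (t * h (x i) / (√(n : ℝ) : ℝ) * Complex.I) := by
    rw [← Complex.exp_sum, ← Finset.sum_mul, ← Finset.sum_div, ← Finset.mul_sum]
    congr 1
    push_cast
    ring
  simp_rw [e]
  rw [integral_fintype_prod_eq_pow
    (fun x => Complex.exp (t * h x / (√(n : ℝ) : ℝ) * Complex.I)), Fintype.card_fin,
    integral_cexp_tiltMeasure hρ hb h n hMn.le, div_pow]
  simp

/-- Asymptotic normality of normalized sums under local alternatives. -/
theorem IsLocalAlternative.tendsto_map_gaussianReal [IsProbabilityMeasure P]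
    {ρ : Lp ℝ 2 P} {Q : ℕ → ProbabilityMeasure Ω} (hQ : IsLocalAlternative P ρ Q)
    (hρ0 : ∫ x, ρ x ∂P = 0) (h : Lp ℝ 2 P) (hh0 : ∫ x, h x ∂P = 0)
    (hT : ∀ n : ℕ, AEMeasurable (fun x : Fin n → Ω => 1 / √(n : ℝ) * ∑ i, h (x i))
      (ProbabilityMeasure.pi fun _ : Fin n => Q n : Measure (Fin n → Ω))) :
    Tendsto (fun n => (ProbabilityMeasure.pi fun _ : Fin n => Q n).map (hT n)) atTop
      (𝓝 (⟨gaussianReal (inner ℝ h ρ) (‖h‖ ^ 2).toNNReal, inferInstance⟩ : ProbabilityMeasure ℝ)) := by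
  have hρ := (Lp.stronglyMeasurable ρ).measurable
  have hh := (Lp.stronglyMeasurable h).measurable
  let b : Ω → ℝ := fun x => |ρ x| + |h x|
  have hb : Measurable b := by fun_prop
  have hbL : MemLp b 2 P := (Lp.memLp ρ).abs.add (Lp.memLp h).abs
  have hρb (x : Ω) : |ρ x| ≤ b x := le_add_of_nonneg_right (abs_nonneg _)
  have hhb (x : Ω) : |h x| ≤ b x := le_add_of_nonneg_left (abs_nonneg _)
  refine ProbabilityMeasure.tendsto_iff_tendsto_charFun.2 fun t => ?_
  have h1 := tendsto_integral_cexp_pi_tiltMeasure hρ hb hbL hρb hρ0 hh hhb hh0 t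
  have hm (n : ℕ) : Measurable fun x : Fin n → Ω => 1 / √(n : ℝ) * ∑ i, h (x i) :=
    (Finset.measurable_sum _ fun i _ => hh.comp (measurable_pi_apply i)).const_mul _
  have h2 := hQ.tendsto_integral_pi_sub_tiltMeasure hb hbL hρb hρ0
    (δ := fun n x => Complex.exp (t * (1 / √(n : ℝ) * ∑ i, h (x i) : ℝ) * Complex.I))
    (fun n => Measurable.stronglyMeasurable
      (((Complex.measurable_ofReal.comp (hm n)).const_mul _).mul_const _).cexp)
    (fun n x => by rw [← Complex.ofReal_mul, Complex.norm_exp_ofReal_mul_I])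
  have h3 := h2.add h1
  simp only [sub_add_cancel, zero_add] at h3
  have hnorm : ∫ x, h x ^ 2 ∂P = ‖h‖ ^ 2 := by
    rw [← real_inner_self_eq_norm_sq, L2.inner_def]
    simp [sq]
  have hinner : ∫ x, h x * ρ x ∂P = inner ℝ h ρ := by
    rw [L2.inner_def]
    simp [mul_comm]
  have hlim : charFun (gaussianReal (inner ℝ h ρ) (‖h‖ ^ 2).toNNReal) t
      = Complex.exp (t * (∫ x, h x * ρ x ∂P : ℝ) * Complex.I
        - (∫ x, h x ^ 2 ∂P : ℝ) * t ^ 2 / 2) := by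
    rw [charFun_gaussianReal, hnorm, hinner, ← NNReal.coe_mk (‖h‖ ^ 2) (sq_nonneg _)]
    simp
  refine Tendsto.congr (fun n => ?_) (h3.trans_eq (by rw [← hlim]; rfl))
  rw [ProbabilityMeasure.toMeasure_map, charFun_apply_real, integral_map (hT n)]
  · rfl
  · fun_prop

end

/-! ### The standard normal distribution function -/

section Normal

theorem monotone_stdNormalCDF : Monotone stdNormalCDF := monotone_cdf _

theorem stdNormalCDF_eq_real_Iic (x : ℝ) : stdNormalCDF x = (gaussianReal 0 1).real (Iic x) :=
  cdf_eq_real _ x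

theorem stdNormalCDF_eq_real_Iio (x : ℝ) : stdNormalCDF x = (gaussianReal 0 1).real (Iio x) := by
  have : NullSingletonClass (gaussianReal 0 1) := nullSingletonClass_gaussianReal one_ne_zero
  rw [stdNormalCDF_eq_real_Iic]
  exact measureReal_congr Iio_ae_eq_Iic.symm

theorem gaussianReal_real_Ioi (m c : ℝ) {s : ℝ} (hs : 0 < s) :
    (gaussianReal m (s ^ 2).toNNReal).real (Ioi c) = stdNormalCDF ((m - c) / s) := by
  have h : (gaussianReal 0 1).map (fun x => m + -s * x) = gaussianReal m (s ^ 2).toNNReal := by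
    have : (fun x : ℝ => m + -s * x) = (fun x => m + x) ∘ (fun x => -s * x) := rfl
    rw [this, ← Measure.map_map (by fun_prop) (by fun_prop), gaussianReal_map_const_mul,
      gaussianReal_map_const_add]
    congr 1
    · ring
    · ext
      simp [hs.le]
  rw [← h, map_measureReal_apply (by fun_prop) measurableSet_Ioi, stdNormalCDF_eq_real_Iio]
  congr 1
  ext x
  simp only [mem_preimage, mem_Ioi, mem_Iio, lt_div_iff₀ hs]
  constructor <;> intro h <;> linarith

theorem stdNormalCDF_neg (x : ℝ) : stdNormalCDF (-x) = 1 - stdNormalCDF x := by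
  have h := gaussianReal_real_Ioi 0 x one_pos
  rw [zero_sub, div_one] at h
  rw [← h, stdNormalCDF_eq_real_Iic, ← probReal_compl_eq_one_sub measurableSet_Iic, compl_Iic]
  simp

/-- Right continuity holds for every distribution function; the symmetry `Φ(-x) = 1 - Φ(x)` turns it
into left continuity. -/
theorem continuous_stdNormalCDF : Continuous stdNormalCDF := by
  have hr (x : ℝ) : ContinuousWithinAt stdNormalCDF (Ici x) x :=
    (cdf (gaussianReal 0 1)).right_continuous x
  refine continuous_iff_continuousAt.2 fun x =>
    continuousAt_iff_continuous_left_right.2 ⟨?_, hr x⟩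
  have h : stdNormalCDF = fun y => 1 - stdNormalCDF (-y) := by
    ext y
    rw [stdNormalCDF_neg, sub_sub_cancel]
  rw [h]
  refine ContinuousWithinAt.sub continuousWithinAt_const ?_
  exact (hr (-x)).comp continuous_neg.continuousWithinAt fun y hy => by simpa using hy

theorem stdNormalCDF_upperPoint {α : ℝ} (hα : α ∈ Ioo (0 : ℝ) 1) :
    stdNormalCDF (upperPoint α) = 1 - α := by
  have hbot : Tendsto stdNormalCDF atBot (𝓝 0) := tendsto_cdf_atBot _
  have htop : Tendsto stdNormalCDF atTop (𝓝 1) := tendsto_cdf_atTop _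
  obtain ⟨l, hl⟩ := (hbot.eventually (gt_mem_nhds (sub_pos.2 hα.2))).exists
  obtain ⟨r, hr⟩ := (htop.eventually (lt_mem_nhds (sub_lt_self 1 hα.1))).exists
  obtain ⟨x, hx⟩ := mem_range_of_exists_le_of_exists_ge continuous_stdNormalCDF ⟨l, hl.le⟩ ⟨r, hr.le⟩
  have hbdd : BddBelow {u : ℝ | 1 - α ≤ stdNormalCDF u} :=
    ⟨l, fun u hu => le_of_not_gt fun h => absurd (monotone_stdNormalCDF h.le) (by
      simp only [mem_ofPred_eq] at hu; linarith)⟩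
  have hcl : IsClosed {u : ℝ | 1 - α ≤ stdNormalCDF u} :=
    isClosed_le continuous_const continuous_stdNormalCDF
  have hx' : x ∈ {u : ℝ | 1 - α ≤ stdNormalCDF u} := hx.ge
  refine le_antisymm ?_ (hcl.csInf_mem ⟨x, hx'⟩ hbdd)
  rw [← hx]
  exact monotone_stdNormalCDF (csInf_le hbdd hx')

end Normal

/-! ### Limiting rejection probabilities and the Neyman–Pearson lemma -/

section

variable {Ω : Type*} [MeasurableSpace Ω] {P : Measure Ω}

theorem npTest_apply (α : ℝ) (g₀ g₁ : Lp ℝ 2 P) (n : ℕ) :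
    (npTest α g₀ g₁).toFun n = ((fun x : Fin n → Ω => 1 / √(n : ℝ) * ∑ i, (g₁ - g₀ : Lp ℝ 2 P) (x i))
      ⁻¹' Ioi (‖g₁ - g₀‖ * upperPoint α + inner ℝ (g₁ - g₀) g₀)).indicator 1 :=
  rfl

/-- The limit law has positive variance since `g₁ ≠ g₀`, so the boundary point of the rejection
half-line is null and weak convergence passes to its probability. The tangent `ρ` is arbitrary: the
test built for one pair is evaluated all over `G₀` and `G₁`. -/
theorem tendsto_rejectionProb_npTest [IsProbabilityMeasure P] {α : ℝ} {g₀ g₁ ρ : Lp ℝ 2 P}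
    {Q : ℕ → ProbabilityMeasure Ω} (hQ : IsLocalAlternative P ρ Q) (hρ0 : ∫ x, ρ x ∂P = 0)
    (hg : ∫ x, (g₁ - g₀ : Lp ℝ 2 P) x ∂P = 0) (hne : g₁ - g₀ ≠ 0) :
    Tendsto (fun n => rejectionProb (npTest α g₀ g₁) n (Q n)) atTop
      (𝓝 (stdNormalCDF (inner ℝ (g₁ - g₀) (ρ - g₀) / ‖g₁ - g₀‖ - upperPoint α))) := by
  set h := g₁ - g₀ with hh
  set c := ‖h‖ * upperPoint α + inner ℝ h g₀ with hc
  have hpos : 0 < ‖h‖ := norm_pos_iff.2 hne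
  have hm (n : ℕ) : Measurable fun x : Fin n → Ω => 1 / √(n : ℝ) * ∑ i, h (x i) :=
    (Finset.measurable_sum _ fun i _ =>
      (Lp.stronglyMeasurable h).measurable.comp (measurable_pi_apply i)).const_mul _
  have hw := hQ.tendsto_map_gaussianReal hρ0 h hg (fun n => (hm n).aemeasurable)
  have hv : (‖h‖ ^ 2).toNNReal ≠ 0 := by
    simpa using hpos.ne'
  have : NullSingletonClass (gaussianReal (inner ℝ h ρ) (‖h‖ ^ 2).toNNReal) :=
    nullSingletonClass_gaussianReal hv
  set G : ProbabilityMeasure ℝ := ⟨gaussianReal (inner ℝ h ρ) (‖h‖ ^ 2).toNNReal, inferInstance⟩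
  have hG : (G : Measure ℝ) = gaussianReal (inner ℝ h ρ) (‖h‖ ^ 2).toNNReal := rfl
  clear_value G
  have hp := ProbabilityMeasure.tendsto_measure_of_null_frontier_of_tendsto' hw (E := Ioi c) (by
    rw [frontier_Ioi, hG]; exact measure_singleton c)
  have hp2 := (ENNReal.tendsto_toReal (measure_ne_top (G : Measure ℝ) _)).comp hp
  have hlim : ((gaussianReal (inner ℝ h ρ) (‖h‖ ^ 2).toNNReal) (Ioi c)).toReal
      = stdNormalCDF (inner ℝ h (ρ - g₀) / ‖h‖ - upperPoint α) := by
    rw [← measureReal_def, gaussianReal_real_Ioi _ _ hpos, inner_sub_right, hc]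
    congr 1
    field_simp
    ring
  rw [hG, hlim] at hp2
  refine hp2.congr fun n => ?_
  unfold rejectionProb
  rw [npTest_apply, integral_indicator_one (hm n measurableSet_Ioi), Function.comp,
    ProbabilityMeasure.toMeasure_map, Measure.map_apply (hm n) measurableSet_Ioi]
  rfl

theorem tiltMass_congr {ρ ρ' b : Ω → ℝ} (h : ρ =ᵐ[P] ρ') (n : ℕ) :
    tiltMass P ρ b n = tiltMass P ρ' b n := by
  refine integral_congr_ae ?_
  filter_upwards [h] with x hx
  simp [truncTilt, indicator, hx]

theorem tiltMeasure_congr {ρ ρ' b : Ω → ℝ} (h : ρ =ᵐ[P] ρ') (n : ℕ) :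
    tiltMeasure P ρ b n = tiltMeasure P ρ' b n := by
  refine withDensity_congr_ae ?_
  filter_upwards [h] with x hx
  rw [tiltMass_congr h]
  simp [truncTilt, indicator, hx]

/-- The **Neyman–Pearson lemma** for products of truncated exponential tilts. -/
theorem integral_pi_tiltMeasure_sub_le [IsProbabilityMeasure P] {ρ h b : Ω → ℝ}
    (hρ : Measurable ρ) (hh : Measurable h) (hb : Measurable b) (hρb : ∀ x, |ρ x| ≤ b x)
    (hρhb : ∀ x, |ρ x + h x| ≤ b x) {n : ℕ} (hn : 1 ≤ n) (h₀ : 0 < tiltMass P ρ b n)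
    (h₁ : 0 < tiltMass P (fun x => ρ x + h x) b n) (c : ℝ) {δ : (Fin n → Ω) → ℝ}
    (hδ : Measurable δ) (hδ1 : ∀ x, δ x ∈ Icc (0 : ℝ) 1) {φ : (Fin n → Ω) → ℝ}
    (hφ : φ = ((fun x : Fin n → Ω => 1 / √(n : ℝ) * ∑ i, h (x i)) ⁻¹' Ioi c).indicator 1) :
    ∫ x, δ x ∂Measure.pi (fun _ : Fin n => tiltMeasure P (fun x => ρ x + h x) b n)
        - Real.exp c * tiltMass P ρ b n ^ n / tiltMass P (fun x => ρ x + h x) b n ^ n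
          * ∫ x, δ x ∂Measure.pi (fun _ : Fin n => tiltMeasure P ρ b n)
      ≤ ∫ x, φ x ∂Measure.pi (fun _ : Fin n => tiltMeasure P (fun x => ρ x + h x) b n)
        - Real.exp c * tiltMass P ρ b n ^ n / tiltMass P (fun x => ρ x + h x) b n ^ n
          * ∫ x, φ x ∂Measure.pi (fun _ : Fin n => tiltMeasure P ρ b n) := by
  set M₀ := tiltMass P ρ b n with hM₀
  set M₁ := tiltMass P (fun x => ρ x + h x) b n with hM₁
  have hρh : Measurable fun x => ρ x + h x := hρ.add hh
  have hS : MeasurableSet ((fun x : Fin n → Ω => 1 / √(n : ℝ) * ∑ i, h (x i)) ⁻¹' Ioi c) :=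
    ((Finset.measurable_sum _ fun i _ => hh.comp (measurable_pi_apply i)).const_mul _)
      measurableSet_Ioi
  have hφm : Measurable φ := by rw [hφ]; exact measurable_one.indicator hS
  have hφ1 (x : Fin n → Ω) : φ x ∈ Icc (0 : ℝ) 1 := by
    rw [hφ]
    by_cases hx : x ∈ (fun x : Fin n → Ω => 1 / √(n : ℝ) * ∑ i, h (x i)) ⁻¹' Ioi c
    · rw [indicator_of_mem hx]; simp
    · rw [indicator_of_notMem hx]; simp
  have hT₀ := (integrable_truncTilt (P := P) hρ hb hρb hn).div_const M₀
  have hT₁ := (integrable_truncTilt (P := P) hρh hb hρhb hn).div_const M₁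
  let L₀ : (Fin n → Ω) → ℝ := fun x => ∏ i, truncTilt ρ b n (x i) / M₀
  let L₁ : (Fin n → Ω) → ℝ := fun x => ∏ i, truncTilt (fun x => ρ x + h x) b n (x i) / M₁
  have hL₀ : Integrable L₀ (Measure.pi fun _ : Fin n => P) := Integrable.fintype_prod fun _ => hT₀
  have hL₁ : Integrable L₁ (Measure.pi fun _ : Fin n => P) := Integrable.fintype_prod fun _ => hT₁
  have hint {L τ : (Fin n → Ω) → ℝ} (hL : Integrable L (Measure.pi fun _ : Fin n => P))
      (hτ : Measurable τ) (hτ1 : ∀ x, τ x ∈ Icc (0 : ℝ) 1) :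
      Integrable (fun x => L x • τ x) (Measure.pi fun _ : Fin n => P) :=
    hL.mul_bdd (c := 1) hτ.aestronglyMeasurable (Eventually.of_forall fun x => by
      rw [Real.norm_of_nonneg (hτ1 x).1]; exact (hτ1 x).2)
  have e₀ (τ : (Fin n → Ω) → ℝ) : ∫ x, τ x ∂Measure.pi (fun _ : Fin n => tiltMeasure P ρ b n)
      = ∫ x, L₀ x • τ x ∂Measure.pi fun _ : Fin n => P :=
    integral_pi_withDensity_ofReal n ((measurable_truncTilt hρ hb n).div_const _)
      (fun x => div_nonneg (truncTilt_nonneg n x) h₀.le) hT₀ τ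
  have e₁ (τ : (Fin n → Ω) → ℝ) :
      ∫ x, τ x ∂Measure.pi (fun _ : Fin n => tiltMeasure P (fun x => ρ x + h x) b n)
      = ∫ x, L₁ x • τ x ∂Measure.pi fun _ : Fin n => P :=
    integral_pi_withDensity_ofReal n ((measurable_truncTilt hρh hb n).div_const _)
      (fun x => div_nonneg (truncTilt_nonneg n x) h₁.le) hT₁ τ
  rw [e₀, e₀, e₁, e₁, ← integral_const_mul, ← integral_const_mul,
    ← integral_sub (hint hL₁ hδ hδ1) ((hint hL₀ hδ hδ1).const_mul _),
    ← integral_sub (hint hL₁ hφm hφ1) ((hint hL₀ hφm hφ1).const_mul _)]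
  refine integral_mono ((hint hL₁ hδ hδ1).sub ((hint hL₀ hδ hδ1).const_mul _))
    ((hint hL₁ hφm hφ1).sub ((hint hL₀ hφm hφ1).const_mul _)) fun x => ?_
  simp only [smul_eq_mul]
  by_cases hx : ∀ i, b (x i) ≤ √(n : ℝ)
  · have p₀ : L₀ x = Real.exp (∑ i, ρ (x i) / √(n : ℝ)) / M₀ ^ n := by
      simp only [L₀, Finset.prod_div_distrib, Finset.prod_const, Finset.card_univ, Fintype.card_fin]
      rw [Real.exp_sum]
      congr 1
      exact Finset.prod_congr rfl fun i _ => indicator_of_mem (s := {x | b x ≤ √(n : ℝ)}) (hx i) _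
    have p₁ : L₁ x = Real.exp (∑ i, ρ (x i) / √(n : ℝ))
        * Real.exp (1 / √(n : ℝ) * ∑ i, h (x i)) / M₁ ^ n := by
      simp only [L₁, Finset.prod_div_distrib, Finset.prod_const, Finset.card_univ, Fintype.card_fin]
      rw [← Real.exp_add, Finset.mul_sum, ← Finset.sum_add_distrib, Real.exp_sum]
      congr 1
      refine Finset.prod_congr rfl fun i _ =>
        (indicator_of_mem (s := {x | b x ≤ √(n : ℝ)}) (hx i) _).trans ?_
      congr 1
      ring
    -- The multiplier is the value of `L₁/L₀` at `Tₙ = c`, so the sign of `L₁ - k L₀` is that of `Tₙ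
    -- - c`, and `φ` maximizes the integrand pointwise.
    have hk : Real.exp c * M₀ ^ n / M₁ ^ n * (Real.exp (∑ i, ρ (x i) / √(n : ℝ)) / M₀ ^ n)
        = Real.exp (∑ i, ρ (x i) / √(n : ℝ)) * Real.exp c / M₁ ^ n := by
      field_simp
    rw [← mul_assoc, ← mul_assoc, ← sub_mul, ← sub_mul, p₀, p₁, hk, ← sub_div, ← mul_sub]
    have hpos : 0 < Real.exp (∑ i, ρ (x i) / √(n : ℝ)) := Real.exp_pos _
    have hM : 0 < M₁ ^ n := pow_pos h₁ n
    by_cases hT : x ∈ (fun x : Fin n → Ω => 1 / √(n : ℝ) * ∑ i, h (x i)) ⁻¹' Ioi c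
    · rw [hφ, indicator_of_mem hT, Pi.one_apply]
      have hT' : c < 1 / √(n : ℝ) * ∑ i, h (x i) := hT
      refine mul_le_mul_of_nonneg_left (hδ1 x).2 (div_nonneg (mul_nonneg hpos.le ?_) hM.le)
      exact sub_nonneg.2 (Real.exp_le_exp.2 hT'.le)
    · rw [hφ, indicator_of_notMem hT, mul_zero]
      have hT' : 1 / √(n : ℝ) * ∑ i, h (x i) ≤ c := not_lt.1 hT
      refine mul_nonpos_of_nonpos_of_nonneg (div_nonpos_of_nonpos_of_nonneg
        (mul_nonpos_of_nonneg_of_nonpos hpos.le ?_) hM.le) (hδ1 x).1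
      exact sub_nonpos.2 (Real.exp_le_exp.2 hT')
  -- If some coordinate is cut off, both product densities vanish: the tilts share their cut-off
  -- set, so there is no singular part to treat.
  · push Not at hx
    obtain ⟨i, hi⟩ := hx
    have hz (f : Ω → ℝ) : truncTilt f b n (x i) = 0 :=
      indicator_of_notMem (s := {x | b x ≤ √(n : ℝ)}) (not_le.2 hi) _
    have z₀ : L₀ x = 0 := Finset.prod_eq_zero (Finset.mem_univ i) (by rw [hz, zero_div])
    have z₁ : L₁ x = 0 := Finset.prod_eq_zero (Finset.mem_univ i) (by rw [hz, zero_div])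
    simp [z₀, z₁]

end

/-! ### Optimality for simple hypotheses -/

section

variable {Ω : Type*} [MeasurableSpace Ω] {P : Measure Ω}

theorem rejectionProb_mem_Icc (δ : AsymptoticTest Ω) (n : ℕ) (Q : ProbabilityMeasure Ω) :
    rejectionProb δ n Q ∈ Icc (0 : ℝ) 1 := by
  refine ⟨integral_nonneg fun x => (δ.mem_Icc n x).1, ?_⟩
  have h := integral_mono_of_nonneg (μ := Measure.pi fun _ : Fin n => (Q : Measure Ω))
    (Eventually.of_forall fun x => (δ.mem_Icc n x).1) (integrable_const 1)
    (Eventually.of_forall fun x => (δ.mem_Icc n x).2)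
  exact h.trans_eq (by simp)

theorem isBoundedUnder_le_rejectionProb (δ : AsymptoticTest Ω) (Q : ℕ → ProbabilityMeasure Ω) :
    IsBoundedUnder (· ≤ ·) atTop fun n => rejectionProb δ n (Q n) :=
  isBoundedUnder_of ⟨1, fun n => (rejectionProb_mem_Icc δ n (Q n)).2⟩

theorem isBoundedUnder_ge_rejectionProb (δ : AsymptoticTest Ω) (Q : ℕ → ProbabilityMeasure Ω) :
    IsBoundedUnder (· ≥ ·) atTop fun n => rejectionProb δ n (Q n) :=
  isBoundedUnder_of ⟨0, fun n => (rejectionProb_mem_Icc δ n (Q n)).1⟩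

theorem asympSize_mem_Icc (δ : AsymptoticTest Ω) (Q : ℕ → ProbabilityMeasure Ω) :
    asympSize δ Q ∈ Icc (0 : ℝ) 1 :=
  ⟨le_limsup_of_le (isBoundedUnder_le_rejectionProb δ Q) fun _ h =>
      let ⟨n, hn⟩ := h.exists; (rejectionProb_mem_Icc δ n (Q n)).1.trans hn,
    limsup_le_of_le (isBoundedUnder_ge_rejectionProb δ Q).isCoboundedUnder_le
      (Eventually.of_forall fun n => (rejectionProb_mem_Icc δ n (Q n)).2)⟩

theorem asympPower_nonneg (δ : AsymptoticTest Ω) (Q : ℕ → ProbabilityMeasure Ω) :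
    0 ≤ asympPower δ Q :=
  le_liminf_of_le (isBoundedUnder_le_rejectionProb δ Q).isCoboundedUnder_ge
    (Eventually.of_forall fun n => (rejectionProb_mem_Icc δ n (Q n)).1)

theorem asympSize_le_maxSize {T : Type*} (Q : T → ℕ → ProbabilityMeasure Ω) {G : Set T} {g : T}
    (hg : g ∈ G) (δ : AsymptoticTest Ω) : asympSize δ (Q g) ≤ maxSize Q G δ :=
  le_ciSup (f := fun g : G => asympSize δ (Q g))
    ⟨1, forall_mem_range.2 fun g => (asympSize_mem_Icc δ (Q g)).2⟩ ⟨g, hg⟩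

theorem minPower_le_asympPower {T : Type*} (Q : T → ℕ → ProbabilityMeasure Ω) {G : Set T} {g : T}
    (hg : g ∈ G) (δ : AsymptoticTest Ω) : minPower Q G δ ≤ asympPower δ (Q g) :=
  ciInf_le (f := fun g : G => asympPower δ (Q g))
    ⟨0, forall_mem_range.2 fun g => asympPower_nonneg δ (Q g)⟩ ⟨g, hg⟩

/-- Asymptotic optimality of the Neyman–Pearson type test for a simple testing problem. -/
theorem asympPower_le_of_asympSize_le [IsProbabilityMeasure P] {α a p : ℝ} {g₀ g₁ : Lp ℝ 2 P}
    {Q₀ Q₁ : ℕ → ProbabilityMeasure Ω} (hQ₀ : IsLocalAlternative P g₀ Q₀)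
    (hQ₁ : IsLocalAlternative P g₁ Q₁) (h₀ : ∫ x, g₀ x ∂P = 0) (h₁ : ∫ x, g₁ x ∂P = 0)
    (ha : Tendsto (fun n => rejectionProb (npTest α g₀ g₁) n (Q₀ n)) atTop (𝓝 a))
    (hp : Tendsto (fun n => rejectionProb (npTest α g₀ g₁) n (Q₁ n)) atTop (𝓝 p))
    (δ : AsymptoticTest Ω) (hδ : asympSize δ Q₀ ≤ a) : asympPower δ Q₁ ≤ p := by
  set φ := npTest α g₀ g₁ with hφ
  have m₀ := (Lp.stronglyMeasurable g₀).measurable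
  have m₁ := (Lp.stronglyMeasurable g₁).measurable
  have mh := (Lp.stronglyMeasurable (g₁ - g₀)).measurable
  let h : Ω → ℝ := (g₁ - g₀ : Lp ℝ 2 P)
  -- The term `|g₁|` is kept because the chosen representatives satisfy `g₁ = g₀ + h` only almost
  -- everywhere, while the domination is required at every point.
  let b : Ω → ℝ := fun x => |g₀ x| + |h x| + |g₁ x|
  have hb : Measurable b := by fun_prop
  have hbL : MemLp b 2 P :=
    ((Lp.memLp g₀).abs.add (Lp.memLp (g₁ - g₀)).abs).add (Lp.memLp g₁).abs
  have hb₀ (x : Ω) : |g₀ x| ≤ b x := by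
    simp only [b]; linarith [abs_nonneg (h x), abs_nonneg (g₁ x)]
  have hb₁ (x : Ω) : |g₁ x| ≤ b x := by
    simp only [b]; linarith [abs_nonneg (h x), abs_nonneg (g₀ x)]
  have hb₂ (x : Ω) : |g₀ x + h x| ≤ b x := by
    simp only [b]; linarith [abs_add_le (g₀ x) (h x), abs_nonneg (g₁ x)]
  have hae : g₁ =ᵐ[P] fun x => g₀ x + h x := by
    filter_upwards [Lp.coeFn_sub g₁ g₀] with x hx
    simp only [h, hx, Pi.sub_apply]
    ring
  let c : ℝ := ‖g₁ - g₀‖ * upperPoint α + inner ℝ (g₁ - g₀) g₀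
  let E₀ (τ : AsymptoticTest Ω) (n : ℕ) : ℝ :=
    ∫ x, τ.toFun n x ∂Measure.pi (fun _ : Fin n => tiltMeasure P g₀ b n)
  let E₁ (τ : AsymptoticTest Ω) (n : ℕ) : ℝ :=
    ∫ x, τ.toFun n x ∂Measure.pi (fun _ : Fin n => tiltMeasure P g₁ b n)
  have hnorm (τ : AsymptoticTest Ω) (n : ℕ) (x : Fin n → Ω) : ‖τ.toFun n x‖ ≤ 1 := by
    rw [Real.norm_of_nonneg (τ.mem_Icc n x).1]; exact (τ.mem_Icc n x).2
  have D₀ (τ : AsymptoticTest Ω) :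
      Tendsto (fun n => rejectionProb τ n (Q₀ n) - E₀ τ n) atTop (𝓝 0) :=
    hQ₀.tendsto_integral_pi_sub_tiltMeasure hb hbL hb₀ h₀
      (fun n => (τ.measurable_toFun n).stronglyMeasurable) (hnorm τ)
  have D₁ (τ : AsymptoticTest Ω) :
      Tendsto (fun n => rejectionProb τ n (Q₁ n) - E₁ τ n) atTop (𝓝 0) :=
    hQ₁.tendsto_integral_pi_sub_tiltMeasure hb hbL hb₁ h₁
      (fun n => (τ.measurable_toFun n).stronglyMeasurable) (hnorm τ)
  let k : ℕ → ℝ := fun n => Real.exp c * tiltMass P g₀ b n ^ n / tiltMass P g₁ b n ^ n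
  -- The value of `K` is irrelevant; convergence is what keeps a size excess `ε` from costing more
  -- than `K ε` in power.
  obtain ⟨K, hK⟩ : ∃ K, Tendsto k atTop (𝓝 K) :=
    ⟨_, ((tendsto_tiltMass_pow m₀ hb hbL hb₀ h₀).const_mul _).div
      (tendsto_tiltMass_pow m₁ hb hbL hb₁ h₁) (Real.exp_ne_zero _)⟩
  have hM₀ := (tendsto_tiltMass m₀ hb hbL hb₀ h₀).eventually (lt_mem_nhds zero_lt_one)
  have hM₁ := (tendsto_tiltMass m₁ hb hbL hb₁ h₁).eventually (lt_mem_nhds zero_lt_one)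
  have bound (ε : ℝ) (hε : 0 < ε) : asympPower δ Q₁ ≤ K * ε + p := by
    -- The Neyman–Pearson inequality for the tilts, rewritten with the true rejection probabilities;
    -- the limsup constraint only bounds the size of `δ` by `a + ε`, and that only eventually.
    have hlim : Tendsto (fun n => k n * (a + ε - (rejectionProb δ n (Q₀ n) - E₀ δ n)
        - rejectionProb φ n (Q₀ n) + (rejectionProb φ n (Q₀ n) - E₀ φ n))
        + rejectionProb φ n (Q₁ n) - (rejectionProb φ n (Q₁ n) - E₁ φ n)
        + (rejectionProb δ n (Q₁ n) - E₁ δ n)) atTop (𝓝 (K * ε + p)) := by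
      have := (((hK.mul ((((D₀ δ).const_sub (a + ε)).sub ha).add (D₀ φ))).add hp).sub (D₁ φ)).add
        (D₁ δ)
      simpa using this
    refine (liminf_le_liminf ?_ (isBoundedUnder_ge_rejectionProb δ Q₁)
      hlim.isBoundedUnder_le.isCoboundedUnder_ge).trans_eq hlim.liminf_eq
    have hsz : ∀ᶠ n in atTop, rejectionProb δ n (Q₀ n) < a + ε :=
      eventually_lt_of_limsup_lt (hδ.trans_lt (lt_add_of_pos_right a hε))
        (isBoundedUnder_le_rejectionProb δ Q₀)
    filter_upwards [hsz, hM₀, hM₁, eventually_ge_atTop 1] with n hn hn₀ hn₁ hn1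
    have hnp := integral_pi_tiltMeasure_sub_le (P := P) m₀ mh hb hb₀ hb₂ hn1 hn₀
      (by rw [← tiltMass_congr hae]; exact hn₁) c (δ.measurable_toFun n) (δ.mem_Icc n)
      (φ := φ.toFun n) (npTest_apply α g₀ g₁ n)
    rw [← tiltMass_congr hae, ← tiltMeasure_congr hae] at hnp
    have hnp' : E₁ δ n - k n * E₀ δ n ≤ E₁ φ n - k n * E₀ φ n := hnp
    have hk : 0 ≤ k n := by simp only [k]; positivity
    have := mul_le_mul_of_nonneg_left hn.le hk
    nlinarith
  have hcont : Tendsto (fun ε => K * ε + p) (𝓝[>] 0) (𝓝 p) := by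
    have : Continuous fun ε : ℝ => K * ε + p := by fun_prop
    simpa using (this.tendsto 0).mono_left nhdsWithin_le_nhds
  refine ge_of_tendsto hcont ?_
  filter_upwards [self_mem_nhdsWithin] with ε hε using bound ε hε

/-! ### Elements of minimum norm -/

/-- The element of minimal norm of a convex set in a Hilbert space supports it. -/
theorem norm_sq_le_inner_of_forall_norm_le {H : Type*} [NormedAddCommGroup H]
    [InnerProductSpace ℝ H] {K : Set H} (hK : Convex ℝ K) {v : H} (hv : v ∈ K)
    (hmin : ∀ w ∈ K, ‖v‖ ≤ ‖w‖) {w : H} (hw : w ∈ K) : ‖v‖ ^ 2 ≤ inner ℝ v w := by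
  have : Nonempty K := ⟨⟨v, hv⟩⟩
  have h : ‖(0 : H) - v‖ = ⨅ w : K, ‖(0 : H) - w‖ := by
    refine le_antisymm (le_ciInf fun w => ?_)
      (ciInf_le ⟨0, forall_mem_range.2 fun _ => norm_nonneg _⟩ (⟨v, hv⟩ : K))
    simpa using hmin w w.2
  have := (norm_eq_iInf_iff_real_inner_le_zero hK hv).1 h w hw
  rw [zero_sub, inner_neg_left, inner_sub_right, real_inner_self_eq_norm_sq] at this
  linarith

theorem existsUnique_forall_norm_le {H : Type*} [NormedAddCommGroup H] [InnerProductSpace ℝ H]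
    [CompleteSpace H] {K : Set H} (hne : K.Nonempty) (hK : Convex ℝ K) (hcl : IsClosed K) :
    ∃! v, v ∈ K ∧ ∀ w ∈ K, ‖v‖ ≤ ‖w‖ := by
  obtain ⟨v, hv, h⟩ := exists_norm_eq_iInf_of_complete_convex hne hcl.isComplete hK 0
  have hmin : ∀ w ∈ K, ‖v‖ ≤ ‖w‖ := fun w hw => by
    have := h.trans_le (ciInf_le ⟨0, forall_mem_range.2 fun _ => norm_nonneg _⟩ (⟨w, hw⟩ : K))
    simpa using this
  refine ⟨v, ⟨hv, hmin⟩, fun w ⟨hw, hwmin⟩ => ?_⟩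
  -- Two minimizers have equal norm, so `‖w - v‖² = 2‖v‖² - 2⟨v, w⟩`, and this inequality makes it
  -- nonpositive.
  have h1 := norm_sq_le_inner_of_forall_norm_le hK hv hmin hw
  have h2 : ‖w‖ = ‖v‖ := le_antisymm (hwmin v hv) (hmin w hw)
  rw [← sub_eq_zero, ← norm_eq_zero, ← sq_eq_zero_iff, norm_sub_sq_real, h2,
    real_inner_comm]
  have h3 := norm_sub_sq_real w v
  rw [h2, real_inner_comm] at h3
  linarith [sq_nonneg ‖w - v‖]

end

/-! ### The saddle point and the maxmin test -/

theorem theorem8p1 {Ω : Type*} [MeasurableSpace Ω] (P : Measure Ω) [IsProbabilityMeasure P]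
    (G₀ G₁ : Set (Lp ℝ 2 P))
    (hG₀ne : G₀.Nonempty) (hG₁ne : G₁.Nonempty)
    (hG₀mean : ∀ g ∈ G₀, ∫ x, g x ∂P = 0) (hG₁mean : ∀ g ∈ G₁, ∫ x, g x ∂P = 0)
    (hdisj : Disjoint G₀ G₁)
    (hG₀conv : Convex ℝ G₀) (hG₁conv : Convex ℝ G₁)
    (hG₀closed : IsClosed G₀) (hG₁closed : IsClosed G₁) (hclosed : IsClosed (G₁ - G₀))
    (α : ℝ) (hα : α ∈ Ioo (0 : ℝ) 1)
    -- `Q ρ n` is the local alternative `P_{n,ρ}`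
    (Q : Lp ℝ 2 P → ℕ → ProbabilityMeasure Ω)
    (hQ : ∀ ρ ∈ G₀ ∪ G₁, IsLocalAlternative P ρ (Q ρ)) :
    (∃! q₁₀ : Lp ℝ 2 P, q₁₀ ∈ G₁ - G₀ ∧ ∀ g ∈ G₁ - G₀, ‖q₁₀‖ ≤ ‖g‖) ∧
    ∀ q₀ ∈ G₀, ∀ q₁ ∈ G₁, (∀ g ∈ G₁ - G₀, ‖q₁ - q₀‖ ≤ ‖g‖) →
      q₁ - q₀ ≠ 0 ∧
      IsSaddlePoint Q G₀ G₁ α (npTest α q₀ q₁) q₀ q₁ ∧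
      IsMaxminTest Q G₀ G₁ α (npTest α q₀ q₁) ∧
      minPower Q G₁ (npTest α q₀ q₁) = stdNormalCDF (-upperPoint α + ‖q₁ - q₀‖) := by
  have hconv : Convex ℝ (G₁ - G₀) := hG₁conv.sub hG₀conv
  refine ⟨existsUnique_forall_norm_le (hG₁ne.sub hG₀ne) hconv hclosed,
    fun q₀ hq₀ q₁ hq₁ hmin => ?_⟩
  have hne : q₁ - q₀ ≠ 0 := fun h =>
    disjoint_left.1 hdisj hq₀ (by rwa [← sub_eq_zero.1 h])
  have hpos : 0 < ‖q₁ - q₀‖ := norm_pos_iff.2 hne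
  have hin {g₀ g₁ : Lp ℝ 2 P} (h₀ : g₀ ∈ G₀) (h₁ : g₁ ∈ G₁) :
      ‖q₁ - q₀‖ ^ 2 ≤ inner ℝ (q₁ - q₀) (g₁ - g₀) :=
    norm_sq_le_inner_of_forall_norm_le hconv (sub_mem_sub hq₁ hq₀) hmin (sub_mem_sub h₁ h₀)
  have hmean : ∫ x, (q₁ - q₀ : Lp ℝ 2 P) x ∂P = 0 := by
    rw [integral_congr_ae (Lp.coeFn_sub q₁ q₀)]
    simp only [Pi.sub_apply]
    rw [integral_sub ((Lp.memLp q₁).integrable one_le_two) ((Lp.memLp q₀).integrable one_le_two),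
      hG₁mean q₁ hq₁, hG₀mean q₀ hq₀, sub_zero]
  set δ := npTest α q₀ q₁
  have lim₀ {g : Lp ℝ 2 P} (hg : g ∈ G₀) := tendsto_rejectionProb_npTest (α := α)
    (hQ g (Or.inl hg)) (hG₀mean g hg) hmean hne
  have lim₁ {g : Lp ℝ 2 P} (hg : g ∈ G₁) := tendsto_rejectionProb_npTest (α := α)
    (hQ g (Or.inr hg)) (hG₁mean g hg) hmean hne
  have hsize : stdNormalCDF (inner ℝ (q₁ - q₀) (q₀ - q₀) / ‖q₁ - q₀‖ - upperPoint α) = α := by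
    rw [sub_self, inner_zero_right, zero_div, zero_sub, stdNormalCDF_neg,
      stdNormalCDF_upperPoint hα, sub_sub_cancel]
  have hpower : stdNormalCDF (inner ℝ (q₁ - q₀) (q₁ - q₀) / ‖q₁ - q₀‖ - upperPoint α)
      = stdNormalCDF (-upperPoint α + ‖q₁ - q₀‖) := by
    rw [real_inner_self_eq_norm_sq, sq, mul_div_cancel_right₀ _ hpos.ne', sub_eq_neg_add]
  have size₀ : asympSize δ (Q q₀) = α := (lim₀ hq₀).limsup_eq.trans hsize
  have power₁ : asympPower δ (Q q₁) = stdNormalCDF (-upperPoint α + ‖q₁ - q₀‖) :=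
    (lim₁ hq₁).liminf_eq.trans hpower
  have size_le : ∀ g₀ ∈ G₀, asympSize δ (Q g₀) ≤ asympSize δ (Q q₀) := fun g₀ hg₀ => by
    refine ((lim₀ hg₀).limsup_eq.trans_le (monotone_stdNormalCDF ?_)).trans_eq
      (lim₀ hq₀).limsup_eq.symm
    gcongr
    -- Varying only the null tangent gives `⟨q₁ - q₀, g₀ - q₀⟩ ≤ 0`.
    have := hin hg₀ hq₁
    rw [← real_inner_self_eq_norm_sq] at this
    simp only [inner_sub_right] at this ⊢
    linarith
  have le_power : ∀ g₁ ∈ G₁, asympPower δ (Q q₁) ≤ asympPower δ (Q g₁) := fun g₁ hg₁ => by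
    refine ((lim₁ hq₁).liminf_eq.trans_le (monotone_stdNormalCDF ?_)).trans_eq
      (lim₁ hg₁).liminf_eq.symm
    gcongr
    have := hin hq₀ hg₁
    rwa [← real_inner_self_eq_norm_sq] at this
  have opt (δ' : AsymptoticTest Ω) (h : asympSize δ' (Q q₀) ≤ α) :
      asympPower δ' (Q q₁) ≤ asympPower δ (Q q₁) :=
    (asympPower_le_of_asympSize_le (hQ q₀ (Or.inl hq₀)) (hQ q₁ (Or.inr hq₁)) (hG₀mean q₀ hq₀)
      (hG₁mean q₁ hq₁) (lim₀ hq₀) (lim₁ hq₁) δ' (h.trans_eq hsize.symm)).trans_eq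
      (lim₁ hq₁).liminf_eq.symm
  have hmaxSize : maxSize Q G₀ δ ≤ α :=
    have : Nonempty G₀ := ⟨⟨q₀, hq₀⟩⟩
    ciSup_le fun g => (size_le g g.2).trans_eq size₀
  have hminPower : minPower Q G₁ δ = asympPower δ (Q q₁) :=
    have : Nonempty G₁ := ⟨⟨q₁, hq₁⟩⟩
    le_antisymm (minPower_le_asympPower Q hq₁ δ) (le_ciInf fun g => le_power g g.2)
  refine ⟨hne, ⟨hq₀, hq₁, ⟨?_, fun δ' h => ?_⟩, size_le, le_power⟩, ⟨hmaxSize, fun δ' h => ?_⟩,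
    hminPower.trans power₁⟩
  · exact (ciSup_unique (s := fun g : ({q₀} : Set (Lp ℝ 2 P)) => asympSize δ (Q g))).trans_le
      size₀.le
  · refine (minPower_le_asympPower Q (mem_singleton q₁) δ').trans ((opt δ' ?_).trans_eq ?_)
    · exact (asympSize_le_maxSize Q (mem_singleton q₀) δ').trans h
    · exact (ciInf_unique (s := fun g : ({q₁} : Set (Lp ℝ 2 P)) => asympPower δ (Q g))).symm
  -- A competitor's minimal power is at most its power at `q₁`, and its level over `G₀` includes
  -- level `α` at `q₀`; the simple problem then bounds it by the power of `δ` at `q₁`, which is the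
  -- minimal power of `δ`.
  · refine (minPower_le_asympPower Q hq₁ δ').trans ((opt δ' ?_).trans_eq hminPower.symm)
    exact (asympSize_le_maxSize Q hq₀ δ').trans h
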